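/- Let $\mathcal D(\mathbb R)$ be the space of complex-valued smooth functions on $\mathbb R$ with compact support and $\mathcal D'(\mathbb R)$ the space of distributions. *The Colombeau algebra.* For $q\in\mathbb N_0$ let $A_q$ be the set of $\varphi\in\mathcal D(\mathbb R)$ with $\int x^j\varphi(x)\,dx=\delta_{0j}$ for $0\le j\le q$; put $\varphi_\varepsilon(x)=\varepsilon^{-1}\varphi(\varepsilon^{-1}x)$ for $\varepsilon>0$ and $s(\varphi)=\sup\{|x|:\varphi(x)\neq0\}$. A function $F:A_0\times\mathbb R\to\mathbb C$, smooth in $x$, is *moderate* if for every compact $K$ and $p\in\mathbb N_0$ there is $q$ such that $\sup_{x\in K}|\partial_x^pF(\varphi_\varepsilon,x)|=O(\varepsilon^{-q})$ as $\varepsilon\to0_+$ for all $\varphi\in A_q$, and *null* if it is moderate and for every compact $K$ and $p$ there is $q$ such that this supremum is $O(\varepsilon^{r-q})$ for all $r\ge q$ and $\varphi\in A_r$. The Colombeau algebra $\mathcal G(\mathbb R)$ is the quotient of the algebra of moderate functions by the ideal of null functions. One writes $F\approx u$ (association), for $F\in\mathcal G(\mathbb R)$ and $u\in\mathcal D'(\mathbb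 R)$, if for some representative and every $\psi\in\mathcal D(\mathbb R)$ there is $q$ with $\lim_{\varepsilon\to0_+}\int F(\varphi_\varepsilon,x)\psi(x)\,dx=\langle u,\psi\rangle$ for all $\varphi\in A_q$. *The distributions.* $\theta$ is the Heaviside function, $\delta$ the Dirac distribution at $0$; $\ln x_+$ equals $\ln x$ for $x>0$ and $0$ for $x<0$; $\ln x_-$ equals $\ln(-x)$ for $x<0$ and $0$ for $x>0$; $\ln|x|\,\mathrm{sgn}\,x=\ln x_+-\ln x_-$. With distributional derivatives, $$x_+^{-2}=-\partial^2\ln x_+-\delta',\qquad x_-^{-2}=-\partial^2\ln x_-+\delta',\qquad x^{-2}\,\mathrm{sgn}\,x=x_+^{-2}-x_-^{-2}.$$ *The models.* Let $D(s,\cdot)\in\mathcal D(\mathbb R)$, $s>0$, be even with $\int D(s,x)\,dx=\frac1s\int D(s,x)^2\,dx=1$, and suppose that for small $s$ the supports lie in one interval $[-l,l]$ and, for each $k$, the functions $\partial_x^kD(s,\cdot)$ are bounded uniformly in $s$. (For example $D(s,x)=f(x)+\lambda_s\,g(x)$ with real-valued even $f,g\in\mathcal D(\mathbb R)$ of disjoint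 supports, $g\ne0$, $\int f=1$, $\int g=0$ and $\lambda_s\in\mathbb C$, $\lambda_s^2=(s-\int f^2)/\int g^2$.) Put $D_\sigma(x)=\sigma^{-1}D(\sigma,x/\sigma)$. The model in $\mathcal G(\mathbb R)$ of $u\in\mathcal D'(\mathbb R)$ is the class of $(\varphi,x)\mapsto(u*D_{s(\varphi)})(x)$. Let $X_+^{-2}$, $X^{-2}\,\mathrm{sgn}\,x$, $H$, $D'$, $\mathrm{Ln}\,x_-$ and $\mathrm{Ln}|x|\,\mathrm{sgn}\,x$ be the models of $x_+^{-2}$, $x^{-2}\,\mathrm{sgn}\,x$, $\theta$, $\delta'$, $\ln x_-$ and $\ln|x|\,\mathrm{sgn}\,x$. **Statement.** In $\mathcal G(\mathbb R)$, $$X^{-2}\,\mathrm{sgn}\,x\cdot H+\mathrm{Ln}|x|\,\mathrm{sgn}\,x\cdot D'\ \approx\ x_+^{-2}+2\delta$$ and $$X_+^{-2}\cdot H-\mathrm{Ln}\,x_-\cdot D'\ \approx\ x_+^{-2}+\delta.$$ -/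

import Mathlib

noncomputable section

namespace Colombeau

open Set Filter Topology MeasureTheory TopologicalSpace
open scoped Distributions ContDiff

/-! ### Test functions and distributions on the real line -/

/-- The space `𝓓(ℝ)` of complex-valued smooth functions with compact support. -/
abbrev Test : Type := 𝓓((⊤ : Opens ℝ), ℂ)

/-- The space `𝓓'(ℝ)` of distributions: continuous `ℂ`-linear forms on `𝓓(ℝ)`. -/
abbrev Distr : Type := Test →L[ℂ] ℂ

/-- The derivative of a test function, as a test function. -/
abbrev dTest : Test →L[ℂ] Test := TestFunction.lineDerivCLM ℂ (1 : ℝ)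

/-- The distributional derivative, `⟨∂u, ψ⟩ = -⟨u, ψ'⟩`. -/
def pd (u : Distr) : Distr := -(u ∘L dTest)

/-- The regular distribution `ψ ↦ ∫ f ψ` of a locally integrable function `f`. -/
def ofFun (f : ℝ → ℂ) : Distr :=
  TestFunction.integralAgainstBilinCLM (ContinuousLinearMap.mul ℂ ℂ) volume f

/-- The Dirac distribution `δ` at the origin. -/
def delta : Distr :=
  TestFunction.mkCLM ℂ (fun ψ : Test => ψ 0) (fun _ _ => rfl) (fun _ _ => rfl)
    (fun _ _ => (continuous_eval_const (0 : ℝ)).comp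
      (TestFunction.continuous_ofSupportedIn (by assumption)))

/-- The Heaviside function: `1` for `x > 0` and `0` for `x < 0`. -/
def thetaFun (x : ℝ) : ℂ := if 0 < x then 1 else 0

/-- `ln x₊`: equal to `ln x` for `x > 0` and to `0` for `x < 0`. -/
def lnPlusFun (x : ℝ) : ℂ := if 0 < x then (Real.log x : ℂ) else 0

/-- `ln x₋`: equal to `ln (-x)` for `x < 0` and to `0` for `x > 0`. -/
def lnMinusFun (x : ℝ) : ℂ := if x < 0 then (Real.log (-x) : ℂ) else 0

theorem locallyIntegrable_thetaFun : LocallyIntegrable thetaFun := by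
  have h : LocallyIntegrable (fun _ : ℝ => (1 : ℂ)) := locallyIntegrable_const _
  have := h.indicator (s := Ioi (0 : ℝ)) measurableSet_Ioi
  refine this.congr (Eventually.of_forall fun x => ?_)
  simp [thetaFun, indicator]

theorem locallyIntegrable_log : LocallyIntegrable (fun x : ℝ => (Real.log x : ℂ)) := by
  intro x
  have h : IntervalIntegrable Real.log volume (x - 1) (x + 1) :=
    intervalIntegral.intervalIntegrable_log'
  rw [intervalIntegrable_iff_integrableOn_Ioc_of_le (by linarith)] at h
  exact ⟨Ioc (x - 1) (x + 1), Ioc_mem_nhds (by linarith) (by linarith), h.ofReal⟩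

theorem locallyIntegrable_lnPlusFun : LocallyIntegrable lnPlusFun := by
  have := locallyIntegrable_log.indicator (s := Ioi (0 : ℝ)) measurableSet_Ioi
  refine this.congr (Eventually.of_forall fun x => ?_)
  simp [lnPlusFun, indicator]

theorem locallyIntegrable_lnMinusFun : LocallyIntegrable lnMinusFun := by
  have := locallyIntegrable_log.indicator (s := Iio (0 : ℝ)) measurableSet_Iio
  refine this.congr (Eventually.of_forall fun x => ?_)
  simp [lnMinusFun, indicator]

/-- `ofFun f` is integration against `f` for every locally integrable `f`. -/
theorem ofFun_apply {f : ℝ → ℂ} (hf : LocallyIntegrable f) (ψ : Test) :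
    ofFun f ψ = ∫ x, f x * ψ x := by
  rw [ofFun, TestFunction.integralAgainstBilinCLM_eq_integral (hf.locallyIntegrableOn _)]
  simp [mul_comm]

/-- The distribution `θ`. -/
def theta : Distr := ofFun thetaFun

/-- The distribution `ln x₊`. -/
def lnPlus : Distr := ofFun lnPlusFun

/-- The distribution `ln x₋`. -/
def lnMinus : Distr := ofFun lnMinusFun

/-- The distribution `ln |x| sgn x = ln x₊ - ln x₋`. -/
def lnAbsSgn : Distr := lnPlus - lnMinus

/-- The distribution `x₊^{-p-1} = ((-1)^p / p!) ∂^{p+1} ln x₊ + ((-1)^p κ_p / p!) δ^{(p)}`,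
where `κ_p = ∑_{k=1}^p 1/k`. -/
def xPlusNegSucc (p : ℕ) : Distr :=
  ((-1 : ℂ) ^ p / p.factorial) • pd^[p + 1] lnPlus +
    ((-1 : ℂ) ^ p * (harmonic p : ℂ) / p.factorial) • pd^[p] delta

/-- The distribution `x₋^{-p-1} = (-1 / p!) ∂^{p+1} ln x₋ + (κ_p / p!) δ^{(p)}`. -/
def xMinusNegSucc (p : ℕ) : Distr :=
  ((-1 : ℂ) / p.factorial) • pd^[p + 1] lnMinus +
    ((harmonic p : ℂ) / p.factorial) • pd^[p] delta

/-- The distribution `x^{-p-1} sgn x = x₊^{-p-1} - (-1)^{p+1} x₋^{-p-1}`. -/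
def xNegSuccSgn (p : ℕ) : Distr :=
  xPlusNegSucc p - (-1 : ℂ) ^ (p + 1) • xMinusNegSucc p

/-! ### Operations on test functions -/

/-- The dilation `x ↦ ε⁻¹ φ(ε⁻¹ x)` of a test function (the zero function for `ε = 0`). -/
def dilate (ε : ℝ) (φ : Test) : Test where
  toFun x := (ε : ℂ)⁻¹ * φ (ε⁻¹ * x)
  contDiff' := contDiff_const.mul (φ.contDiff.comp (contDiff_const.mul contDiff_id))
  hasCompactSupport' := by
    rcases eq_or_ne ε 0 with rfl | h
    · simpa using! (HasCompactSupport.zero : HasCompactSupport (0 : ℝ → ℂ))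
    · exact (φ.hasCompactSupport.comp_homeomorph (Homeomorph.mulLeft₀ ε⁻¹ (inv_ne_zero h))).mul_left
  tsupport_subset' := by simp

@[simp] theorem dilate_apply (ε : ℝ) (φ : Test) (x : ℝ) :
    dilate ε φ x = (ε : ℂ)⁻¹ * φ (ε⁻¹ * x) := rfl

/-- The test function `y ↦ ψ(x - y)`. -/
def reflTranslate (x : ℝ) (ψ : Test) : Test where
  toFun y := ψ (x - y)
  contDiff' := ψ.contDiff.comp (contDiff_const.sub contDiff_id)
  hasCompactSupport' := ψ.hasCompactSupport.comp_homeomorph (Homeomorph.subLeft x)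
  tsupport_subset' := by simp

@[simp] theorem reflTranslate_apply (x : ℝ) (ψ : Test) (y : ℝ) :
    reflTranslate x ψ y = ψ (x - y) := rfl

/-- The convolution `(u * ψ)(x) = ⟨u_y, ψ(x - y)⟩` of a distribution and a test function. -/
def conv (u : Distr) (ψ : Test) (x : ℝ) : ℂ := u (reflTranslate x ψ)

theorem dTest_apply (ψ : Test) (x : ℝ) : dTest ψ x = deriv ψ x := by
  rw [TestFunction.lineDerivCLM_apply_of_le (by simp)]
  simp [lineDeriv, deriv_comp_const_add]

theorem coe_dTest_iterate (p : ℕ) (ψ : Test) : ⇑(dTest^[p] ψ) = iteratedDeriv p ψ := by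
  induction p with
  | zero => simp
  | succ p ih =>
    rw [Function.iterate_succ_apply', iteratedDeriv_succ]
    funext x
    rw [dTest_apply, ih]

/-- On test functions supported in a fixed interval a distribution is bounded by finitely many
sup-norms of derivatives. -/
theorem exists_seminorm_bound (u : Distr) (R : ℝ) :
    ∃ (C : ℝ) (N : ℕ), 0 ≤ C ∧ ∀ (χ : Test) (B : ℝ), 0 ≤ B →
      (∀ y, R < |y| → χ y = 0) → (∀ i ≤ N, ∀ y, ‖iteratedDeriv i χ y‖ ≤ B) → ‖u χ‖ ≤ C * B := by
  let K : Compacts ℝ := ⟨Icc (-R) R, isCompact_Icc⟩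
  have hK : (K : Set ℝ) ⊆ (⊤ : Opens ℝ) := by simp
  let T : 𝓓^{⊤}_{K}(ℝ, ℂ) →L[ℂ] ℂ := u ∘L TestFunction.ofSupportedInCLM ℂ hK
  have hc : Continuous ((normSeminorm ℂ ℂ).comp T.toLinearMap) :=
    continuous_norm.comp T.continuous
  obtain ⟨s, C, -, hC⟩ := Seminorm.bound_of_continuous
    (ContDiffMapSupportedIn.withSeminorms ℂ ℝ ℂ ⊤ K) _ hc
  refine ⟨C, s.sup id, C.2, fun χ B hB hs hd => ?_⟩
  have hsupp : Function.support χ ⊆ K := by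
    intro y hy
    by_contra hy'
    refine hy (hs y ?_)
    by_contra h
    exact hy' (abs_le.mp (not_lt.mp h))
  let χK : 𝓓^{⊤}_{K}(ℝ, ℂ) := .of_support_subset χ.contDiff hsupp
  have e : T χK = u χ := rfl
  have h1 : ‖T χK‖ ≤ C * (s.sup (ContDiffMapSupportedIn.seminorm ℂ ℝ ℂ ⊤ K)) χK := hC χK
  rw [← e]
  refine h1.trans (mul_le_mul_of_nonneg_left ?_ C.2)
  refine Seminorm.finset_sup_apply_le hB fun i hi => ?_
  rw [ContDiffMapSupportedIn.seminorm_top_le_iff ℂ hB]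
  intro x _
  rw [norm_iteratedFDeriv_eq_norm_iteratedDeriv]
  exact hd i (Finset.le_sup (f := id) hi) x

theorem iteratedDeriv_reflTranslate (i : ℕ) (x : ℝ) (ψ : Test) (y : ℝ) :
    iteratedDeriv i (reflTranslate x ψ) y = (-1 : ℝ) ^ i • iteratedDeriv i ψ (x - y) := by
  have := congrFun (iteratedDeriv_comp_const_sub i (f := (ψ : ℝ → ℂ)) x) y
  simpa using! this

theorem exists_iteratedDeriv_bound (ψ : Test) (i : ℕ) :
    ∃ M : ℝ, ∀ y, ‖iteratedDeriv i ψ y‖ ≤ M := by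
  rw [← coe_dTest_iterate]
  exact (dTest^[i] ψ).continuous.bounded_above_of_compact_support (dTest^[i] ψ).hasCompactSupport

theorem exists_support_bound (ψ : Test) : ∃ M : ℝ, ∀ y, M < |y| → ψ y = 0 := by
  obtain ⟨M, hM⟩ := ψ.hasCompactSupport.isBounded.exists_norm_le
  refine ⟨M, fun y hy => ?_⟩
  by_contra h
  exact absurd (hM y (subset_tsupport _ h)) (not_le.mpr hy)

theorem taylor_bound {f : ℝ → ℂ} {M : ℝ} (hf : ContDiff ℝ ∞ f)
    (hM : ∀ y, ‖deriv (deriv f) y‖ ≤ M) (a h : ℝ) :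
    ‖f (a + h) - f a - h • deriv f a‖ ≤ M * |h| ^ 2 := by
  have hM0 : 0 ≤ M := (norm_nonneg _).trans (hM 0)
  have hf1 : Differentiable ℝ f := hf.differentiable (by simp)
  have hf2 : Differentiable ℝ (deriv f) :=
    ((contDiff_infty_iff_deriv.mp hf).2).differentiable (by simp)
  have h1 : ∀ t ∈ uIcc a (a + h), ‖deriv f t - deriv f a‖ ≤ M * |h| := by
    intro t ht
    have := (convex_univ (𝕜 := ℝ) (E := ℝ)).norm_image_sub_le_of_norm_deriv_le
      (f := deriv f) (C := M) (fun x _ => hf2 x) (fun x _ => hM x) (mem_univ a) (mem_univ t)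
    refine this.trans (mul_le_mul_of_nonneg_left ?_ hM0)
    have := abs_sub_left_of_mem_uIcc ht
    simpa using this
  have := (convex_uIcc a (a + h)).norm_image_sub_le_of_norm_hasDerivWithin_le
    (f := fun t => f t - t • deriv f a) (f' := fun t => deriv f t - deriv f a) (C := M * |h|)
    (fun t _ => by
      have h2 : HasDerivAt (fun t : ℝ => t • deriv f a) ((1 : ℝ) • deriv f a) t :=
        (hasDerivAt_id t).smul_const _
      simpa using! ((hf1 t).hasDerivAt.sub h2).hasDerivWithinAt) h1 left_mem_uIcc right_mem_uIcc
  have e : f (a + h) - f a - h • deriv f a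
      = (f (a + h) - (a + h) • deriv f a) - (f a - a • deriv f a) := by
    rw [add_smul]; ring
  rw [e]
  refine this.trans (le_of_eq ?_)
  rw [add_sub_cancel_left, Real.norm_eq_abs]
  ring

theorem hasDerivAt_conv (u : Distr) (ψ : Test) (x : ℝ) :
    HasDerivAt (conv u ψ) (conv u (dTest ψ) x) x := by
  obtain ⟨R, hR⟩ := exists_support_bound ψ
  obtain ⟨R', hR'⟩ := exists_support_bound (dTest ψ)
  obtain ⟨C, N, hC, hb⟩ := exists_seminorm_bound u (|x| + 1 + max R R')
  choose M hM using fun i => exists_iteratedDeriv_bound ψ i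
  let B : ℝ := ∑ i ∈ Finset.range (N + 1), |M (i + 2)|
  have hB : 0 ≤ B := Finset.sum_nonneg fun _ _ => abs_nonneg _
  have key : ∀ h : ℝ, |h| ≤ 1 →
      ‖conv u ψ (x + h) - conv u ψ x - h • conv u (dTest ψ) x‖ ≤ C * (B * |h| ^ 2) := by
    intro h hh
    let χ : Test := reflTranslate (x + h) ψ - reflTranslate x ψ - (h : ℂ) • reflTranslate x (dTest ψ)
    have e : conv u ψ (x + h) - conv u ψ x - h • conv u (dTest ψ) x = u χ := by
      simp only [χ, map_sub, map_smul, conv]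
      simp
    have hχ : (χ : ℝ → ℂ) = (reflTranslate (x + h) ψ : ℝ → ℂ) - reflTranslate x ψ
        - (h : ℝ) • (reflTranslate x (dTest ψ) : ℝ → ℂ) := by
      funext y
      simp [χ]
    rw [e]
    refine hb χ _ (by positivity) (fun y hy => ?_) (fun i hi y => ?_)
    · have h1 : max R R' + 1 < |x - y| := by
        have := abs_sub_abs_le_abs_sub y x
        rw [abs_sub_comm] at this
        linarith
      have h2 : max R R' < |x + h - y| := by
        have := abs_sub_abs_le_abs_sub (x - y) (-h)
        rw [abs_neg, sub_neg_eq_add, show x - y + h = x + h - y by ring] at this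
        linarith
      rw [hχ]
      simp only [Pi.sub_apply, Pi.smul_apply, reflTranslate_apply]
      rw [hR _ ((le_max_left _ _).trans_lt h2),
        hR _ ((le_max_left R R').trans_lt (by linarith)),
        hR' _ ((le_max_right R R').trans_lt (by linarith))]
      simp
    · have cd : ∀ (z : ℝ) (φ : Test), ContDiffAt ℝ i (reflTranslate z φ) y := fun z φ =>
        ((reflTranslate z φ).contDiff.of_le (by exact_mod_cast le_top)).contDiffAt
      have e2 : iteratedDeriv i (dTest ψ) (x - y) = deriv (iteratedDeriv i ψ) (x - y) := by
        rw [← iteratedDeriv_succ, iteratedDeriv_succ']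
        rw [show deriv (ψ : ℝ → ℂ) = dTest ψ from funext fun z => (dTest_apply ψ z).symm]
      have cd1 : ContDiffAt ℝ i ((reflTranslate (x + h) ψ : ℝ → ℂ) - (reflTranslate x ψ : ℝ → ℂ)) y :=
        (cd _ _).sub (cd _ _)
      have cd2 : ContDiffAt ℝ i (h • (reflTranslate x (dTest ψ) : ℝ → ℂ)) y :=
        (cd _ _).const_smul h
      rw [hχ, iteratedDeriv_sub cd1 cd2,
        iteratedDeriv_sub (cd _ _) (cd _ _), iteratedDeriv_const_smul (cd _ _),
        iteratedDeriv_reflTranslate, iteratedDeriv_reflTranslate, iteratedDeriv_reflTranslate,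
        smul_comm, ← smul_sub, ← smul_sub, norm_smul, e2]
      have t := taylor_bound (f := iteratedDeriv i ψ) (M := M (i + 2))
        (by rw [← coe_dTest_iterate]; exact (dTest^[i] ψ).contDiff)
        (fun z => by rw [← iteratedDeriv_succ, ← iteratedDeriv_succ]; exact hM (i + 2) z) (x - y) h
      rw [show x + h - y = x - y + h by ring]
      simp only [norm_pow, norm_neg, norm_one, one_pow, one_mul]
      refine t.trans (mul_le_mul_of_nonneg_right ?_ (by positivity))
      exact (le_abs_self _).trans (Finset.single_le_sum (f := fun i => |M (i + 2)|)
        (fun _ _ => abs_nonneg _) (Finset.mem_range.mpr (by omega)))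
  rw [hasDerivAt_iff_isLittleO_nhds_zero]
  refine Asymptotics.IsBigO.trans_isLittleO (g := fun h : ℝ => h ^ 2) ?_ ?_
  · refine Asymptotics.IsBigO.of_bound (C * B) ?_
    filter_upwards [Metric.closedBall_mem_nhds (0 : ℝ) one_pos] with h hh
    have := key h (by simpa using hh)
    simpa [mul_assoc] using this
  · simpa using! Asymptotics.isLittleO_pow_id (𝕜 := ℝ) (n := 2) (by norm_num)

theorem iteratedDeriv_conv (u : Distr) (ψ : Test) (p : ℕ) :
    iteratedDeriv p (conv u ψ) = conv u (dTest^[p] ψ) := by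
  induction p with
  | zero => simp
  | succ p ih =>
    rw [iteratedDeriv_succ, ih, Function.iterate_succ_apply']
    funext x
    exact (hasDerivAt_conv u _ x).deriv

theorem contDiff_conv (u : Distr) (ψ : Test) : ContDiff ℝ ∞ (conv u ψ) := by
  refine contDiff_of_differentiable_iteratedDeriv fun m _ => ?_
  rw [iteratedDeriv_conv]
  exact fun x => (hasDerivAt_conv u _ x).differentiableAt

/-! ### The Colombeau algebra -/

/-- The set `A_q` of test functions with `∫ x^j φ = δ_{0j}` for `j = 0, 1, …, q`. -/
def A (q : ℕ) : Set Test :=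
  {φ | ∀ j ≤ q, ∫ x : ℝ, (x : ℂ) ^ j * φ x = if j = 0 then 1 else 0}

theorem dilate_mem_A {q : ℕ} {φ : Test} (hφ : φ ∈ A q) {ε : ℝ} (hε : 0 < ε) :
    dilate ε φ ∈ A q := by
  intro j hj
  have hc : (ε : ℂ) ≠ 0 := by exact_mod_cast hε.ne'
  have h1 : ∀ x : ℝ, (x : ℂ) ^ j * dilate ε φ x
      = ((ε : ℂ) ^ j * (ε : ℂ)⁻¹) * (((ε⁻¹ * x : ℝ) : ℂ) ^ j * φ (ε⁻¹ * x)) := by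
    intro x
    rw [dilate_apply]
    push_cast
    rw [mul_pow, inv_pow]
    field_simp
  simp_rw [h1]
  rw [integral_const_mul,
    Measure.integral_comp_mul_left (fun x : ℝ => (x : ℂ) ^ j * φ x) ε⁻¹, hφ j hj]
  split_ifs with h
  · subst h
    rw [inv_inv, abs_of_pos hε]
    simp [hc]
  · simp

/-- The parameter set `A_0` of the Colombeau algebra, as a type. -/
abbrev A0 : Type := {φ : Test // φ ∈ A 0}

/-- `φ_ε(x) = ε⁻¹ φ(ε⁻¹ x)` for `ε > 0`; only the behaviour as `ε → 0₊` is ever used, and `φ_ε`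
is given the irrelevant value `φ` for `ε ≤ 0`. -/
def scale (φ : A0) (ε : ℝ) : A0 :=
  if h : 0 < ε then ⟨dilate ε φ.1, dilate_mem_A φ.2 h⟩ else φ

/-- The moderate functions `F(φ, x)`: smooth in `x`, and for all compact `K` and all `p` there is
`q` such that `sup_{x ∈ K} |∂^p F(φ_ε, x)| = O(ε^{-q})` as `ε → 0₊`, for every `φ ∈ A_q`. -/
def IsModerate (F : A0 → ℝ → ℂ) : Prop :=
  (∀ φ, ContDiff ℝ ∞ (F φ)) ∧
  ∀ K : Set ℝ, IsCompact K → ∀ p : ℕ, ∃ q : ℕ, ∀ φ : A0, φ.1 ∈ A q → ∃ C : ℝ,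
    ∀ᶠ ε in 𝓝[>] (0 : ℝ), ∀ x ∈ K, ‖iteratedDeriv p (F (scale φ ε)) x‖ ≤ C * (ε ^ q)⁻¹

/-- The null functions: for all compact `K` and all `p` there is `q` such that
`sup_{x ∈ K} |∂^p F(φ_ε, x)| = O(ε^{r-q})` as `ε → 0₊`, for all `r ≥ q` and `φ ∈ A_r`. -/
def IsNull (F : A0 → ℝ → ℂ) : Prop :=
  ∀ K : Set ℝ, IsCompact K → ∀ p : ℕ, ∃ q : ℕ, ∀ r ≥ q, ∀ φ : A0, φ.1 ∈ A r → ∃ C : ℝ,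
    ∀ᶠ ε in 𝓝[>] (0 : ℝ), ∀ x ∈ K, ‖iteratedDeriv p (F (scale φ ε)) x‖ ≤ C * ε ^ (r - q)

theorem A_anti {q r : ℕ} (h : q ≤ r) : A r ⊆ A q := fun _ hφ j hj => hφ j (hj.trans h)

theorem eventually_Ioc : ∀ᶠ ε in 𝓝[>] (0 : ℝ), ε ∈ Ioc (0 : ℝ) 1 :=
  Ioc_mem_nhdsGT one_pos

theorem IsModerate.exists_uniform {F : A0 → ℝ → ℂ} (hF : IsModerate F) {K : Set ℝ}
    (hK : IsCompact K) (p : ℕ) :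
    ∃ q : ℕ, ∀ φ : A0, φ.1 ∈ A q → ∃ C : ℝ, 0 ≤ C ∧ ∀ᶠ ε in 𝓝[>] (0 : ℝ), ∀ i ≤ p, ∀ x ∈ K,
      ‖iteratedDeriv i (F (scale φ ε)) x‖ ≤ C * (ε ^ q)⁻¹ := by
  choose q hq using hF.2 K hK
  refine ⟨(Finset.range (p + 1)).sup q, fun φ hφ => ?_⟩
  have hle : ∀ i ≤ p, q i ≤ (Finset.range (p + 1)).sup q := fun i hi =>
    Finset.le_sup (Finset.mem_range.mpr (by omega))
  have h : ∀ i, ∃ C : ℝ, i ≤ p → ∀ᶠ ε in 𝓝[>] (0 : ℝ), ∀ x ∈ K,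
      ‖iteratedDeriv i (F (scale φ ε)) x‖ ≤ C * (ε ^ q i)⁻¹ := by
    intro i
    by_cases hi : i ≤ p
    · obtain ⟨C, hC⟩ := hq i φ (A_anti (hle i hi) hφ)
      exact ⟨C, fun _ => hC⟩
    · exact ⟨0, fun h => absurd h hi⟩
  choose C hC using h
  have hall : ∀ᶠ ε in 𝓝[>] (0 : ℝ), ∀ i ∈ Finset.range (p + 1), ∀ x ∈ K,
      ‖iteratedDeriv i (F (scale φ ε)) x‖ ≤ C i * (ε ^ q i)⁻¹ :=
    (Filter.eventually_all_finset _).mpr fun i hi => hC i (by simpa [Nat.lt_succ_iff] using hi)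
  refine ⟨∑ i ∈ Finset.range (p + 1), |C i|, Finset.sum_nonneg fun _ _ => abs_nonneg _, ?_⟩
  filter_upwards [hall, eventually_Ioc] with ε h1 h2 i hi x hx
  have hm : i ∈ Finset.range (p + 1) := Finset.mem_range.mpr (by omega)
  have hε := h2.1
  refine (h1 i hm x hx).trans ?_
  refine mul_le_mul ?_ ?_ (by positivity) (Finset.sum_nonneg fun _ _ => abs_nonneg _)
  · exact (le_abs_self _).trans
      (Finset.single_le_sum (f := fun i => |C i|) (fun _ _ => abs_nonneg _) hm)
  · exact inv_anti₀ (by positivity) (pow_le_pow_of_le_one hε.le h2.2 (hle i hi))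

theorem IsNull.exists_uniform {F : A0 → ℝ → ℂ} (hF : IsNull F) {K : Set ℝ}
    (hK : IsCompact K) (p : ℕ) :
    ∃ q : ℕ, ∀ r ≥ q, ∀ φ : A0, φ.1 ∈ A r → ∃ C : ℝ, 0 ≤ C ∧
      ∀ᶠ ε in 𝓝[>] (0 : ℝ), ∀ i ≤ p, ∀ x ∈ K,
        ‖iteratedDeriv i (F (scale φ ε)) x‖ ≤ C * ε ^ (r - q) := by
  choose q hq using hF K hK
  refine ⟨(Finset.range (p + 1)).sup q, fun r hr φ hφ => ?_⟩
  have hle : ∀ i ≤ p, q i ≤ (Finset.range (p + 1)).sup q := fun i hi =>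
    Finset.le_sup (Finset.mem_range.mpr (by omega))
  have h : ∀ i, ∃ C : ℝ, i ≤ p → ∀ᶠ ε in 𝓝[>] (0 : ℝ), ∀ x ∈ K,
      ‖iteratedDeriv i (F (scale φ ε)) x‖ ≤ C * ε ^ (r - q i) := by
    intro i
    by_cases hi : i ≤ p
    · obtain ⟨C, hC⟩ := hq i r ((hle i hi).trans hr) φ hφ
      exact ⟨C, fun _ => hC⟩
    · exact ⟨0, fun h => absurd h hi⟩
  choose C hC using h
  have hall : ∀ᶠ ε in 𝓝[>] (0 : ℝ), ∀ i ∈ Finset.range (p + 1), ∀ x ∈ K,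
      ‖iteratedDeriv i (F (scale φ ε)) x‖ ≤ C i * ε ^ (r - q i) :=
    (Filter.eventually_all_finset _).mpr fun i hi => hC i (by simpa [Nat.lt_succ_iff] using hi)
  refine ⟨∑ i ∈ Finset.range (p + 1), |C i|, Finset.sum_nonneg fun _ _ => abs_nonneg _, ?_⟩
  filter_upwards [hall, eventually_Ioc] with ε h1 h2 i hi x hx
  have hm : i ∈ Finset.range (p + 1) := Finset.mem_range.mpr (by omega)
  have hε := h2.1
  refine (h1 i hm x hx).trans ?_
  refine mul_le_mul ?_ ?_ (by positivity) (Finset.sum_nonneg fun _ _ => abs_nonneg _)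
  · exact (le_abs_self _).trans
      (Finset.single_le_sum (f := fun i => |C i|) (fun _ _ => abs_nonneg _) hm)
  · exact pow_le_pow_of_le_one hε.le h2.2 (by have := hle i hi; omega)

theorem norm_iteratedDeriv_mul_le' {f g : ℝ → ℂ} (hf : ContDiff ℝ ∞ f) (hg : ContDiff ℝ ∞ g)
    {p : ℕ} {x a b : ℝ} (ha : 0 ≤ a) (hfa : ∀ i ≤ p, ‖iteratedDeriv i f x‖ ≤ a)
    (hgb : ∀ i ≤ p, ‖iteratedDeriv i g x‖ ≤ b) :
    ‖iteratedDeriv p (f * g) x‖ ≤ 2 ^ p * (a * b) := by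
  have h := norm_iteratedFDeriv_mul_le hf hg x (n := p) (by exact_mod_cast le_top)
  simp only [norm_iteratedFDeriv_eq_norm_iteratedDeriv] at h
  refine h.trans ?_
  calc _ ≤ ∑ i ∈ Finset.range (p + 1), (p.choose i : ℝ) * (a * b) := by
        refine Finset.sum_le_sum fun i hi => ?_
        rw [mul_assoc]
        refine mul_le_mul_of_nonneg_left ?_ (by positivity)
        exact mul_le_mul (hfa i (by simpa [Nat.lt_succ_iff] using hi)) (hgb _ (by omega))
          (norm_nonneg _) ha
    _ = 2 ^ p * (a * b) := by
        rw [← Finset.sum_mul]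
        exact_mod_cast congrArg (fun n : ℕ => (n : ℝ) * (a * b)) (Nat.sum_range_choose p)

theorem IsModerate.add {F G : A0 → ℝ → ℂ} (hF : IsModerate F) (hG : IsModerate G) :
    IsModerate (F + G) := by
  refine ⟨fun φ => (hF.1 φ).add (hG.1 φ), fun K hK p => ?_⟩
  obtain ⟨q₁, h₁⟩ := hF.2 K hK p
  obtain ⟨q₂, h₂⟩ := hG.2 K hK p
  refine ⟨max q₁ q₂, fun φ hφ => ?_⟩
  obtain ⟨C₁, h₁⟩ := h₁ φ (A_anti (le_max_left _ _) hφ)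
  obtain ⟨C₂, h₂⟩ := h₂ φ (A_anti (le_max_right _ _) hφ)
  refine ⟨|C₁| + |C₂|, ?_⟩
  filter_upwards [h₁, h₂, eventually_Ioc] with ε h₁ h₂ h₃ x hx
  have hε := h₃.1
  have cd : ∀ {H : A0 → ℝ → ℂ}, IsModerate H → ContDiffAt ℝ p (H (scale φ ε)) x := fun hH =>
    ((hH.1 _).of_le (by exact_mod_cast le_top)).contDiffAt
  rw [Pi.add_apply, iteratedDeriv_add (cd hF) (cd hG), add_mul]
  refine (norm_add_le _ _).trans (add_le_add ((h₁ x hx).trans ?_) ((h₂ x hx).trans ?_))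
  · exact mul_le_mul (le_abs_self _) (inv_anti₀ (by positivity)
      (pow_le_pow_of_le_one hε.le h₃.2 (le_max_left _ _))) (by positivity) (abs_nonneg _)
  · exact mul_le_mul (le_abs_self _) (inv_anti₀ (by positivity)
      (pow_le_pow_of_le_one hε.le h₃.2 (le_max_right _ _))) (by positivity) (abs_nonneg _)

theorem IsModerate.mul {F G : A0 → ℝ → ℂ} (hF : IsModerate F) (hG : IsModerate G) :
    IsModerate (F * G) := by
  refine ⟨fun φ => (hF.1 φ).mul (hG.1 φ), fun K hK p => ?_⟩
  obtain ⟨q₁, h₁⟩ := hF.exists_uniform hK p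
  obtain ⟨q₂, h₂⟩ := hG.exists_uniform hK p
  refine ⟨q₁ + q₂, fun φ hφ => ?_⟩
  obtain ⟨C₁, hC₁, h₁⟩ := h₁ φ (A_anti (Nat.le_add_right _ _) hφ)
  obtain ⟨C₂, hC₂, h₂⟩ := h₂ φ (A_anti (Nat.le_add_left _ _) hφ)
  refine ⟨2 ^ p * (C₁ * C₂), ?_⟩
  filter_upwards [h₁, h₂, eventually_Ioc] with ε h₁ h₂ h₃ x hx
  have hε := h₃.1
  refine (norm_iteratedDeriv_mul_le' (hF.1 _) (hG.1 _) (by positivity)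
    (fun i hi => h₁ i hi x hx) (fun i hi => h₂ i hi x hx)).trans (le_of_eq ?_)
  rw [pow_add, mul_inv]
  ring

theorem isModerate_const (c : ℂ) : IsModerate (fun _ _ => c) := by
  refine ⟨fun _ => contDiff_const, fun K _ p => ⟨0, fun φ _ => ⟨‖c‖, Eventually.of_forall ?_⟩⟩⟩
  intro ε x _
  rw [iteratedDeriv_const]
  split_ifs <;> simp

theorem IsNull.add {F G : A0 → ℝ → ℂ} (mF : IsModerate F) (mG : IsModerate G)
    (hF : IsNull F) (hG : IsNull G) : IsNull (F + G) := by
  intro K hK p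
  obtain ⟨q₁, h₁⟩ := hF K hK p
  obtain ⟨q₂, h₂⟩ := hG K hK p
  refine ⟨max q₁ q₂, fun r hr φ hφ => ?_⟩
  obtain ⟨C₁, h₁⟩ := h₁ r ((le_max_left _ _).trans hr) φ hφ
  obtain ⟨C₂, h₂⟩ := h₂ r ((le_max_right _ _).trans hr) φ hφ
  refine ⟨|C₁| + |C₂|, ?_⟩
  filter_upwards [h₁, h₂, eventually_Ioc] with ε h₁ h₂ h₃ x hx
  have hε := h₃.1
  have cd : ∀ {H : A0 → ℝ → ℂ}, IsModerate H → ContDiffAt ℝ p (H (scale φ ε)) x := fun hH =>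
    ((hH.1 _).of_le (by exact_mod_cast le_top)).contDiffAt
  rw [Pi.add_apply, iteratedDeriv_add (cd mF) (cd mG), add_mul]
  refine (norm_add_le _ _).trans (add_le_add ((h₁ x hx).trans ?_) ((h₂ x hx).trans ?_))
  · exact mul_le_mul (le_abs_self _) (pow_le_pow_of_le_one hε.le h₃.2 (by omega))
      (by positivity) (abs_nonneg _)
  · exact mul_le_mul (le_abs_self _) (pow_le_pow_of_le_one hε.le h₃.2 (by omega))
      (by positivity) (abs_nonneg _)

theorem IsNull.mul_left {F G : A0 → ℝ → ℂ} (mF : IsModerate F) (mG : IsModerate G)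
    (hG : IsNull G) : IsNull (F * G) := by
  intro K hK p
  obtain ⟨q₁, h₁⟩ := mF.exists_uniform hK p
  obtain ⟨q₂, h₂⟩ := hG.exists_uniform hK p
  refine ⟨q₁ + q₂, fun r hr φ hφ => ?_⟩
  obtain ⟨C₁, hC₁, h₁⟩ := h₁ φ (A_anti (by omega) hφ)
  obtain ⟨C₂, hC₂, h₂⟩ := h₂ r (by omega) φ hφ
  refine ⟨2 ^ p * (C₁ * C₂), ?_⟩
  filter_upwards [h₁, h₂, eventually_Ioc] with ε h₁ h₂ h₃ x hx
  have hε := h₃.1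
  refine (norm_iteratedDeriv_mul_le' (mF.1 _) (mG.1 _) (by positivity)
    (fun i hi => h₁ i hi x hx) (fun i hi => h₂ i hi x hx)).trans (le_of_eq ?_)
  rw [show r - q₂ = q₁ + (r - (q₁ + q₂)) by omega, pow_add]
  field_simp

/-- The algebra of moderate functions, with pointwise operations. -/
def moderate : Subalgebra ℂ (A0 → ℝ → ℂ) where
  carrier := {F | IsModerate F}
  mul_mem' := IsModerate.mul
  add_mem' := IsModerate.add
  algebraMap_mem' := isModerate_const

/-- The ideal of null functions in the algebra of moderate functions. -/
def nullIdeal : Ideal moderate where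
  carrier := {F | IsNull F.1}
  add_mem' := fun {F G} hF hG => IsNull.add F.2 G.2 hF hG
  zero_mem' := by
    intro K _ p
    refine ⟨0, fun r _ φ _ => ⟨0, Eventually.of_forall fun ε x _ => ?_⟩⟩
    have : iteratedDeriv p (fun _ : ℝ => (0 : ℂ)) x = 0 := by simp
    exact (norm_eq_zero.mpr this).le.trans (by simp)
  smul_mem' := fun F G hG => IsNull.mul_left F.2 G.2 hG

/-- The Colombeau algebra `𝓖(ℝ)` of generalized functions. -/
abbrev GenFun : Type := moderate ⧸ nullIdeal

/-- `F ≈ u`: the generalized function `F` is associated with the distribution `u`, i.e. for some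
representative `f` of `F` and every test function `ψ` there is `q` such that
`∫ f(φ_ε, x) ψ(x) dx → ⟨u, ψ⟩` as `ε → 0₊`, for every `φ ∈ A_q`. -/
def AssociatedWith (F : GenFun) (u : Distr) : Prop :=
  ∃ f : moderate, Ideal.Quotient.mk nullIdeal f = F ∧
    ∀ ψ : Test, ∃ q : ℕ, ∀ φ : A0, φ.1 ∈ A q →
      Tendsto (fun ε : ℝ => ∫ x : ℝ, f.1 (scale φ ε) x * ψ x) (𝓝[>] 0) (𝓝 (u ψ))

/-! ### Modelling of singularities -/

/-- `s(φ) = sup {|x| : φ(x) ≠ 0}`. -/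
def size (φ : Test) : ℝ := sSup {r : ℝ | ∃ x : ℝ, φ x ≠ 0 ∧ r = |x|}

/-- A family `D(s, ·)`, `s > 0`, of even test functions with
`∫ D(s, x) dx = (1/s) ∫ D(s, x)² dx = 1`, whose supports lie in a common interval `[-l, l]` and
whose derivatives of each order are uniformly bounded, for small `s`. The standard example is
`D(s, x) = f(x) + λ_s g(x)`, see `DeltaFamily.ofPair`. -/
structure DeltaFamily where
  /-- The test function `D(s, ·)`; only the values at `s > 0` matter. -/
  toFun : ℝ → Test
  even : ∀ s > 0, ∀ x, toFun s (-x) = toFun s x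
  integral_eq_one : ∀ s > 0, ∫ x : ℝ, toFun s x = 1
  integral_sq : ∀ s : ℝ, s > 0 → (1 / (s : ℂ)) * ∫ x : ℝ, toFun s x ^ 2 = 1
  support_bound : ∃ l : ℝ, ∀ᶠ s in 𝓝[>] (0 : ℝ), ∀ x, l < |x| → toFun s x = 0
  deriv_bound : ∀ k : ℕ, ∃ C : ℝ, ∀ᶠ s in 𝓝[>] (0 : ℝ), ∀ x, ‖iteratedDeriv k (toFun s) x‖ ≤ C

theorem size_pos (φ : A0) : 0 < size φ.1 := by
  obtain ⟨M, hM⟩ := exists_support_bound φ.1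
  have hne : ∃ x : ℝ, φ.1 x ≠ 0 ∧ x ≠ 0 := by
    by_contra! h
    have h0 : ∫ x : ℝ, φ.1 x = 0 := by
      rw [integral_eq_zero_of_ae]
      have : ∀ᵐ x : ℝ, x ≠ 0 := by simp [ae_iff]
      filter_upwards [this] with x hx
      by_contra h'
      exact hx (h x h')
    have h1 := φ.2 0 le_rfl
    simp [h0] at h1
  obtain ⟨x, hx, hx0⟩ := hne
  refine (abs_pos.mpr hx0).trans_le (le_csSup ⟨M, ?_⟩ ⟨x, hx, rfl⟩)
  rintro r ⟨y, hy, rfl⟩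
  by_contra h
  exact hy (hM y (not_le.mp h))

open scoped Pointwise in
theorem size_dilate {ε : ℝ} (hε : 0 < ε) (φ : Test) : size (dilate ε φ) = ε * size φ := by
  have hs : {r : ℝ | ∃ x : ℝ, dilate ε φ x ≠ 0 ∧ r = |x|}
      = ε • {r : ℝ | ∃ x : ℝ, φ x ≠ 0 ∧ r = |x|} := by
    ext r
    simp only [mem_smul_set, mem_ofPred_eq, dilate_apply, smul_eq_mul]
    constructor
    · rintro ⟨x, hx, rfl⟩
      refine ⟨|ε⁻¹ * x|, ⟨ε⁻¹ * x, right_ne_zero_of_mul hx, rfl⟩, ?_⟩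
      rw [abs_mul, abs_of_pos (inv_pos.mpr hε), mul_inv_cancel_left₀ hε.ne']
    · rintro ⟨_, ⟨x, hx, rfl⟩, rfl⟩
      refine ⟨ε * x, mul_ne_zero (by simp [hε.ne']) ?_, by rw [abs_mul, abs_of_pos hε]⟩
      rwa [inv_mul_cancel_left₀ hε.ne']
  rw [size, hs, Real.sSup_smul_of_nonneg hε.le, size, smul_eq_mul]

theorem iteratedDeriv_dilate (i : ℕ) (ε : ℝ) (φ : Test) (x : ℝ) :
    iteratedDeriv i (dilate ε φ) x = (ε : ℂ)⁻¹ ^ (i + 1) * iteratedDeriv i φ (ε⁻¹ * x) := by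
  induction i generalizing x with
  | zero => simp
  | succ i ih =>
    have hd : HasDerivAt (iteratedDeriv i φ) (iteratedDeriv (i + 1) φ (ε⁻¹ * x)) (ε⁻¹ * x) := by
      rw [iteratedDeriv_succ, ← coe_dTest_iterate]
      exact ((dTest^[i] φ).contDiff.differentiable (by simp) _).hasDerivAt
    have h2 : HasDerivAt (fun x : ℝ => ε⁻¹ * x) ε⁻¹ x := by
      simpa using (hasDerivAt_id x).const_mul ε⁻¹
    have h3 := (hd.scomp x h2).const_mul ((ε : ℂ)⁻¹ ^ (i + 1))
    rw [iteratedDeriv_succ, funext ih]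
    refine h3.deriv.trans ?_
    rw [Complex.real_smul]
    push_cast
    ring

namespace DeltaFamily

/-- The test function `D_σ(x) = σ⁻¹ D(σ, x/σ)`. -/
def net (D : DeltaFamily) (σ : ℝ) : Test := dilate σ (D.toFun σ)

/-- The representative `(φ, x) ↦ (u * D_σ)(x)`, `σ = s(φ)`, of the model of `u`. -/
def rep (D : DeltaFamily) (u : Distr) (φ : A0) (x : ℝ) : ℂ := conv u (D.net (size φ.1)) x

theorem isModerate_rep (D : DeltaFamily) (u : Distr) : IsModerate (D.rep u) := by
  refine ⟨fun φ => contDiff_conv u _, fun K hK p => ?_⟩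
  obtain ⟨R, hR⟩ := hK.isBounded.exists_norm_le
  obtain ⟨l, hl⟩ := D.support_bound
  choose M hM using D.deriv_bound
  obtain ⟨C, N, hC, hb⟩ := exists_seminorm_bound u (R + |l|)
  refine ⟨N + p + 1, fun φ _ => ?_⟩
  have hs := size_pos φ
  let B : ℝ := ∑ i ∈ Finset.range (N + 1), |M (i + p)|
  have hB : 0 ≤ B := Finset.sum_nonneg fun _ _ => abs_nonneg _
  refine ⟨C * (B * (size φ.1 ^ (N + p + 1))⁻¹), ?_⟩
  have ht : Tendsto (fun ε : ℝ => ε * size φ.1) (𝓝[>] 0) (𝓝[>] 0) := by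
    refine tendsto_nhdsWithin_iff.mpr ⟨?_, ?_⟩
    · have : Tendsto (fun ε : ℝ => ε * size φ.1) (𝓝 0) (𝓝 (0 * size φ.1)) :=
        tendsto_id.mul_const _
      rw [zero_mul] at this
      exact this.mono_left nhdsWithin_le_nhds
    · filter_upwards [self_mem_nhdsWithin] with ε hε
      exact mul_pos hε hs
  have hall : ∀ᶠ s in 𝓝[>] (0 : ℝ), ∀ i ∈ Finset.range (N + 1),
      ∀ x, ‖iteratedDeriv (i + p) (D.toFun s) x‖ ≤ M (i + p) :=
    (Filter.eventually_all_finset _).mpr fun i _ => hM (i + p)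
  filter_upwards [self_mem_nhdsWithin, ht.eventually hl, ht.eventually hall,
    ht.eventually eventually_Ioc] with ε hε h1 h2 h3 x hx
  have hε' : 0 < ε := hε
  set σ := ε * size φ.1 with hσ
  have hσ0 : 0 < σ := h3.1
  have e : D.rep u (scale φ ε) = conv u (D.net σ) := by
    funext y
    rw [rep, scale, dif_pos hε', size_dilate hε']
  rw [e, iteratedDeriv_conv, conv]
  have hexp : C * (B * (size φ.1 ^ (N + p + 1))⁻¹) * (ε ^ (N + p + 1))⁻¹
      = C * (B * (σ ^ (N + p + 1))⁻¹) := by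
    rw [hσ, mul_pow, mul_inv]; ring
  rw [hexp]
  refine hb _ _ (by positivity) (fun y hy => ?_) (fun i hi y => ?_)
  · rw [reflTranslate_apply, coe_dTest_iterate, net, iteratedDeriv_dilate]
    have hxR := hR x hx
    rw [Real.norm_eq_abs] at hxR
    have h4 : |l| < |x - y| := by
      have := abs_sub_abs_le_abs_sub y x
      rw [abs_sub_comm] at this
      linarith
    have h5 : |l| < |σ⁻¹ * (x - y)| := by
      rw [abs_mul, abs_of_pos (inv_pos.mpr hσ0)]
      refine h4.trans_le (le_mul_of_one_le_left (abs_nonneg _) ?_)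
      exact (one_le_inv₀ hσ0).mpr h3.2
    have h6 : (D.toFun σ : ℝ → ℂ) =ᶠ[𝓝 (σ⁻¹ * (x - y))] fun _ => 0 := by
      have : {z : ℝ | |l| < |z|} ∈ 𝓝 (σ⁻¹ * (x - y)) :=
        (isOpen_lt continuous_const continuous_abs).mem_nhds h5
      filter_upwards [this] with z hz
      exact h1 z ((le_abs_self l).trans_lt hz)
    rw [h6.iteratedDeriv_eq]
    simp
  · rw [iteratedDeriv_reflTranslate, norm_smul, ← coe_dTest_iterate, ← Function.iterate_add_apply,
      coe_dTest_iterate, net, iteratedDeriv_dilate]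
    simp only [norm_pow, norm_neg, norm_one, one_pow, one_mul, norm_mul, norm_inv,
      Complex.norm_real, Real.norm_eq_abs, abs_of_pos hσ0]
    rw [mul_comm]
    refine mul_le_mul ?_ ?_ (by positivity) hB
    · refine (h2 i (Finset.mem_range.mpr (by omega)) _).trans ?_
      exact (le_abs_self _).trans (Finset.single_le_sum (f := fun i => |M (i + p)|)
        (fun _ _ => abs_nonneg _) (Finset.mem_range.mpr (by omega)))
    · rw [inv_pow]
      exact inv_anti₀ (by positivity) (pow_le_pow_of_le_one hσ0.le h3.2 (by omega))

/-- The generalized function modelling the distribution `u`: the class of `u * D_σ`. -/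
def model (D : DeltaFamily) (u : Distr) : GenFun :=
  Ideal.Quotient.mk nullIdeal ⟨D.rep u, D.isModerate_rep u⟩

/-- A real-valued test function, regarded as complex-valued. -/
def ofRealTest (f : 𝓓((⊤ : Opens ℝ), ℝ)) : Test := TestFunction.postcompCLM Complex.ofRealCLM f

@[simp] theorem ofRealTest_apply (f : 𝓓((⊤ : Opens ℝ), ℝ)) (x : ℝ) : ofRealTest f x = f x := rfl

theorem integral_sq_ofPair (f g : 𝓓((⊤ : Opens ℝ), ℝ)) (c : ℂ)
    (hfg : Disjoint (Function.support f) (Function.support g)) (hg0 : g ≠ 0) {s : ℝ} (hs : s > 0)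
    (hc : c ^ 2 = (((s - ∫ x : ℝ, f x ^ 2) / ∫ x : ℝ, g x ^ 2 : ℝ) : ℂ)) :
    (1 / (s : ℂ)) * ∫ x : ℝ, (ofRealTest f + c • ofRealTest g) x ^ 2 = 1 := by
  have hi : ∀ h : 𝓓((⊤ : Opens ℝ), ℝ), Integrable (fun x => h x ^ 2) := by
    intro h
    have hcs : HasCompactSupport (fun x => h x ^ 2) := by
      refine h.hasCompactSupport.mono fun x hx h0 => hx ?_
      simp [h0]
    exact (h.continuous.pow 2).integrable_of_hasCompactSupport hcs
  have hgpos : 0 < ∫ x : ℝ, g x ^ 2 := by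
    obtain ⟨x, hx⟩ : ∃ x, g x ≠ 0 := by
      by_contra! h
      exact hg0 (TestFunction.ext h)
    have hpos : 0 < g x ^ 2 := by positivity
    rw [integral_pos_iff_support_of_nonneg (fun x => sq_nonneg (g x)) (hi g)]
    have ho : IsOpen (Function.support fun x => g x ^ 2) :=
      (g.continuous.pow 2).isOpen_support
    exact ho.measure_pos _ ⟨x, hpos.ne'⟩
  have hfi : Integrable (fun x => ((f x ^ 2 : ℝ) : ℂ)) := (hi f).ofReal
  have hgi : Integrable (fun x => ((g x ^ 2 : ℝ) : ℂ)) := (hi g).ofReal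
  have hmul : ∀ x, f x * g x = 0 := by
    intro x
    by_contra h
    exact Set.disjoint_left.mp hfg (left_ne_zero_of_mul h : f x ≠ 0)
      (right_ne_zero_of_mul h : g x ≠ 0)
  have hint : ∫ x : ℝ, ((f x : ℂ) + c * (g x : ℂ)) ^ 2 = s := by
    have e : ∀ x, ((f x : ℂ) + c * (g x : ℂ)) ^ 2
        = ((f x ^ 2 : ℝ) : ℂ) + c ^ 2 * ((g x ^ 2 : ℝ) : ℂ) := by
      intro x
      have : (f x : ℂ) * (g x : ℂ) = 0 := by exact_mod_cast hmul x
      push_cast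
      linear_combination (2 * c) * this
    simp_rw [e]
    rw [integral_add hfi (hgi.const_mul _), integral_const_mul, integral_complex_ofReal,
      integral_complex_ofReal, hc]
    rw [← Complex.ofReal_mul, div_mul_cancel₀ _ hgpos.ne', ← Complex.ofReal_add]
    simp
  have hs' : (s : ℂ) ≠ 0 := by exact_mod_cast (ne_of_gt hs)
  have : (1 / (s : ℂ)) * ∫ x : ℝ, ((f x : ℂ) + c * (g x : ℂ)) ^ 2 = 1 := by
    rw [hint]; field_simp
  simpa using this

/-- The family `D(s, x) = f(x) + λ_s g(x)`, where `f, g` are real-valued even test functions with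
disjoint supports, `∫ f = 1`, `∫ g = 0`, `g ≠ 0` and `λ_s² = (s - ∫ f²) / ∫ g²`. -/
def ofPair (f g : 𝓓((⊤ : Opens ℝ), ℝ)) (lam : ℝ → ℂ)
    (hfe : ∀ x, f (-x) = f x) (hge : ∀ x, g (-x) = g x)
    (hfg : Disjoint (Function.support f) (Function.support g))
    (hf : ∫ x : ℝ, f x = 1) (hg : ∫ x : ℝ, g x = 0) (hg0 : g ≠ 0)
    (hlam : ∀ s > 0, lam s ^ 2 = (((s - ∫ x : ℝ, f x ^ 2) / ∫ x : ℝ, g x ^ 2 : ℝ) : ℂ)) :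
    DeltaFamily where
  toFun s := ofRealTest f
    + lam s • ofRealTest g
  even s _ x := by simp [hfe, hge]
  integral_eq_one s _ := by
    have hfi : Integrable (fun x => (f x : ℂ)) :=
      (f.continuous.integrable_of_hasCompactSupport f.hasCompactSupport).ofReal
    have hgi : Integrable (fun x => (g x : ℂ)) :=
      (g.continuous.integrable_of_hasCompactSupport g.hasCompactSupport).ofReal
    have : ∫ x : ℝ, ((f x : ℂ) + lam s * (g x : ℂ)) = 1 := by
      rw [integral_add hfi (hgi.const_mul _), integral_const_mul, integral_complex_ofReal,
        integral_complex_ofReal, hf, hg]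
      simp
    simpa using this
  integral_sq s hs := integral_sq_ofPair f g (lam s) hfg hg0 hs (hlam s hs)
  support_bound := by
    obtain ⟨M₁, h₁⟩ := exists_support_bound (ofRealTest f)
    obtain ⟨M₂, h₂⟩ := exists_support_bound (ofRealTest g)
    refine ⟨max M₁ M₂, Eventually.of_forall fun s x hx => ?_⟩
    have e : (ofRealTest f + lam s • ofRealTest g) x
        = ofRealTest f x + lam s * ofRealTest g x := rfl
    rw [e, h₁ x ((le_max_left _ _).trans_lt hx), h₂ x ((le_max_right _ _).trans_lt hx)]
    simp
  deriv_bound k := by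
    set F : Test := ofRealTest f
    set G : Test := ofRealTest g
    obtain ⟨M₁, h₁⟩ := exists_iteratedDeriv_bound F k
    obtain ⟨M₂, h₂⟩ := exists_iteratedDeriv_bound G k
    set a : ℝ := ∫ x : ℝ, f x ^ 2
    set b : ℝ := ∫ x : ℝ, g x ^ 2
    refine ⟨M₁ + (1 + (1 + |a|) / |b|) * M₂, ?_⟩
    filter_upwards [eventually_Ioc] with s hs x
    have hl : ‖lam s‖ ≤ 1 + (1 + |a|) / |b| := by
      have h3 : ‖lam s‖ ^ 2 ≤ (1 + |a|) / |b| := by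
        rw [← norm_pow, hlam s hs.1, Complex.norm_real, Real.norm_eq_abs, abs_div]
        refine div_le_div_of_nonneg_right ?_ (abs_nonneg _)
        refine (abs_sub _ _).trans ?_
        rw [abs_of_pos hs.1]
        linarith [hs.2]
      nlinarith [norm_nonneg (lam s), sq_nonneg (‖lam s‖ - 1)]
    have cd : ∀ H : Test, ContDiffAt ℝ k H x := fun H =>
      (H.contDiff.of_le (by exact_mod_cast le_top)).contDiffAt
    have e : ⇑(F + lam s • G) = (F : ℝ → ℂ) + lam s • (G : ℝ → ℂ) := by
      funext y; simp
    have cd2 : ContDiffAt ℝ k (lam s • (G : ℝ → ℂ)) x := (cd G).const_smul (lam s)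
    rw [e, iteratedDeriv_add (cd F) cd2, iteratedDeriv_const_smul (cd G)]
    refine (norm_add_le _ _).trans (add_le_add (h₁ x) ?_)
    rw [norm_smul]
    exact mul_le_mul hl (h₂ x) (norm_nonneg _) (by positivity)

end DeltaFamily


end Colombeau

end

noncomputable section
namespace Colombeau
open Set Filter Topology MeasureTheory TopologicalSpace
open scoped Distributions ContDiff

/-! ### Convolution with a test function -/

/-! Write d for D_σ, and H, L₊, L₋ for the convolutions of d with θ, ln x₊, ln x₋; put L = L₊ - L₋
and Λ = L₊ + L₋, so that H' = d and Λ is the smoothing of ln|x|. The individual products diverge,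
but integration by parts removes every divergent term before a limit is taken.

In the first product, which is (-L'' - 2d')H + L d', transferring both derivatives off L'' produces
a term -L d' that cancels the added one. Since d'H = (H²)''/2 - d², testing against ψ leaves -∫ L H
ψ'' - 2∫ L d ψ' - ∫ H² ψ'' + 2∫ d² ψ (`integral_xNegSuccSgn_product`). In the second product, (-L₊''
- d')H - L₋ d', the same manipulation leaves -∫ Λ d' ψ. One more integration by parts turns it into
Λ'd and Λd terms, and the latter combines with -2∫ L₊ d ψ' into -∫ L d ψ'
(`integral_xPlusNegSucc_product`).

The limits are then as follows. The integrals of L H ψ'' and L₊ H ψ'' both tend to ∫ ln x₊ ψ'', and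
∫ H² ψ'' tends to -ψ'(0), by dominated convergence (`tendsto_integral_conv_mul_conv_theta`,
`tendsto_integral_conv_theta_sq`). The products of a smoothing with d are handled by Taylor
expansion of the test function at 0: once the remainder is negligible, only the moments of order 0
and 1 count (`tendsto_integral_mul_mollifier_mul_sub_taylor`). For d² they are 1, by the
normalisation of D, and 0, by parity, so d² → δ. For L d the first is 0 by parity and the second
tends to 0. For Λ'd they are 0 by parity and exactly 1/2, so ∫ Λ'd ψ → ψ'(0)/2.

The value 1/2 (`integral_conv_log_dTest_mul_mulId`) comes from symmetrising the formal double
integral of x a(x) a(y)/(x - y): exchanging x and y and averaging replaces x/(x - y) by 1/2. The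
distribution x₊⁻² acts as -∫ ln x₊ ψ'' + ψ'(0); the remaining terms are 2ψ(0) and ψ(0). -/

@[fun_prop]
theorem continuous_test (a : Test) : Continuous a := a.continuous

@[fun_prop]
theorem continuous_conv (u : Distr) (a : Test) : Continuous (conv u a) :=
  (contDiff_conv u a).continuous

theorem hasDerivAt_test (a : Test) (x : ℝ) : HasDerivAt a (dTest a x) x := by
  rw [dTest_apply]
  exact (a.contDiff.differentiable (by simp) x).hasDerivAt

theorem integrable_mul_test {g : ℝ → ℂ} (hg : Continuous g) (a : Test) :
    Integrable fun x => g x * a x :=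
  (hg.mul a.continuous).integrable_of_hasCompactSupport a.hasCompactSupport.mul_left

theorem conv_ofFun {f : ℝ → ℂ} (hf : LocallyIntegrable f) (a : Test) (x : ℝ) :
    conv (ofFun f) a x = ∫ y, f y * a (x - y) := by
  rw [conv, ofFun_apply hf]
  rfl

theorem dTest_reflTranslate (x : ℝ) (a : Test) :
    dTest (reflTranslate x a) = -reflTranslate x (dTest a) := by
  ext y
  rw [dTest_apply, ← iteratedDeriv_one, iteratedDeriv_reflTranslate, iteratedDeriv_one,
    ← dTest_apply]
  change _ = -(dTest a (x - y))
  simp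

theorem pd_apply (u : Distr) (ψ : Test) : pd u ψ = -u (dTest ψ) := rfl

theorem conv_pd (u : Distr) (a : Test) (x : ℝ) : conv (pd u) a x = conv u (dTest a) x := by
  rw [conv, pd_apply, dTest_reflTranslate, map_neg, neg_neg, conv]

theorem delta_apply (ψ : Test) : delta ψ = ψ 0 := rfl

theorem conv_delta (a : Test) (x : ℝ) : conv delta a x = a x := by
  rw [conv, delta_apply, reflTranslate_apply, sub_zero]

theorem theta_apply (ψ : Test) : theta ψ = ∫ x, thetaFun x * ψ x :=
  ofFun_apply locallyIntegrable_thetaFun ψ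

theorem pd_theta : pd theta = delta := by
  ext ψ
  have h1 : ∀ x, thetaFun x * dTest ψ x = (Ioi (0 : ℝ)).indicator (deriv ψ) x := by
    intro x
    rw [dTest_apply]
    simp [thetaFun, indicator]
  rw [pd_apply, theta_apply, delta_apply, integral_congr_ae (Eventually.of_forall h1),
    integral_indicator measurableSet_Ioi,
    HasCompactSupport.integral_Ioi_deriv_eq (ψ.contDiff.of_le (by simp)) ψ.hasCompactSupport,
    neg_neg]

theorem conv_theta_dTest (a : Test) (x : ℝ) : conv theta (dTest a) x = a x := by
  rw [← conv_pd, pd_theta, conv_delta]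

theorem hasDerivAt_conv_theta (a : Test) (x : ℝ) : HasDerivAt (conv theta a) (a x) x := by
  simpa only [conv_theta_dTest] using hasDerivAt_conv theta a x

theorem integral_conv_mul {f : ℝ → ℂ} (hf : LocallyIntegrable f) (a : Test) {w : ℝ → ℂ}
    (hw : Continuous w) (hc : HasCompactSupport w) :
    ∫ x, conv (ofFun f) a x * w x = ∫ y, f y * ∫ x, a (x - y) * w x := by
  obtain ⟨R, hR⟩ := exists_support_bound a
  obtain ⟨S, hS⟩ := hc.isBounded.exists_norm_le
  obtain ⟨A, hA⟩ := a.continuous.bounded_above_of_compact_support a.hasCompactSupport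
  obtain ⟨B, hB⟩ := hw.bounded_above_of_compact_support hc
  have hwS : ∀ x, S < |x| → w x = 0 := by
    intro x hx
    by_contra h
    exact absurd (hS x (subset_tsupport _ h)) (not_le.mpr hx)
  set K := Icc (-(S + R)) (S + R)
  -- Only local integrability of f is available. The supports of a and w make the integrand vanish
  -- for y outside K, so truncating f there costs nothing and provides a product-integrable function
  -- for Fubini.
  have hfK : Integrable (K.indicator f) :=
    (hf.integrableOn_isCompact isCompact_Icc).integrable_indicator measurableSet_Icc
  have hwi : Integrable w := hw.integrable_of_hasCompactSupport hc
  have hprod : Integrable (Function.uncurry fun x y => f y * a (x - y) * w x)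
      ((volume : Measure ℝ).prod volume) := by
    have h1 : Integrable (fun p : ℝ × ℝ => w p.1 * K.indicator f p.2)
        ((volume : Measure ℝ).prod volume) := hwi.mul_prod hfK
    have h2 := h1.bdd_mul (c := A) (f := fun p : ℝ × ℝ => a (p.1 - p.2))
      (by fun_prop) (Eventually.of_forall fun p => hA _)
    refine h2.congr (Eventually.of_forall fun p => ?_)
    obtain ⟨x, y⟩ := p
    simp only [Function.uncurry]
    by_cases hy : y ∈ K
    · rw [indicator_of_mem hy]; ring
    · rw [indicator_of_notMem hy]
      by_cases hx : S < |x|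
      · rw [hwS x hx]; ring
      · have : R < |x - y| := by
          have h3 : S + R < |y| := by
            by_contra h
            exact hy (abs_le.mp (not_lt.mp h))
          have := abs_sub_abs_le_abs_sub y x
          rw [abs_sub_comm] at this
          linarith
        rw [hR _ this]; ring
  calc ∫ x, conv (ofFun f) a x * w x = ∫ x, ∫ y, f y * a (x - y) * w x := by
        congr 1; funext x
        rw [conv_ofFun hf, integral_mul_const]
    _ = ∫ y, ∫ x, f y * a (x - y) * w x := integral_integral_swap hprod
    _ = _ := by
        congr 1; funext y
        rw [← integral_const_mul]
        simp only [mul_assoc]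

/-- The kernel f(x - y) is symmetric when f is even. -/
theorem integral_conv_mul_comm {f : ℝ → ℂ} (hf : LocallyIntegrable f)
    (he : ∀ x, f (-x) = f x) (a b : Test) :
    ∫ x, conv (ofFun f) a x * b x = ∫ x, conv (ofFun f) b x * a x := by
  rw [integral_conv_mul hf a b.continuous b.hasCompactSupport,
    integral_conv_mul hf b a.continuous a.hasCompactSupport, ← integral_neg_eq_self]
  congr 1; funext y
  rw [he, ← integral_add_right_eq_self _ (-y)]
  congr 2; funext x
  rw [mul_comm, show x + -y - -y = x by ring, ← sub_eq_add_neg]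

/-! ### Integration by parts -/

theorem integral_deriv_mul_test {F F' : ℝ → ℂ} (hF : ∀ x, HasDerivAt F (F' x) x)
    (hF' : Continuous F') (ψ : Test) :
    ∫ x, F' x * ψ x = -∫ x, F x * dTest ψ x := by
  have hFc : Continuous F := continuous_iff_continuousAt.mpr fun x => (hF x).continuousAt
  rw [eq_neg_iff_add_eq_zero, ← integral_add (integrable_mul_test hF' ψ)
    (integrable_mul_test hFc (dTest ψ))]
  exact integral_eq_zero_of_hasDerivAt_of_integrable
    (fun x => (hF x).mul (hasDerivAt_test ψ x))
    ((integrable_mul_test hF' ψ).add (integrable_mul_test hFc (dTest ψ)))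
    (integrable_mul_test hFc ψ)

theorem integral_eq_zero_of_odd {f : ℝ → ℂ} (h : ∀ x, f (-x) = -f x) : ∫ x, f x = 0 := by
  have := integral_neg_eq_self f volume
  simp only [h, integral_neg] at this
  exact CharZero.eq_neg_self_iff.mp this.symm

/-! ### The convolution of `ln |x|` with a test function -/

/-- The test function `x ↦ x a(x)`. -/
def mulId (a : Test) : Test where
  toFun x := (x : ℂ) * a x
  contDiff' := Complex.ofRealCLM.contDiff.mul a.contDiff
  hasCompactSupport' := a.hasCompactSupport.mul_left
  tsupport_subset' := by simp

@[simp] theorem mulId_apply (a : Test) (x : ℝ) : mulId a x = x * a x := rfl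

theorem dTest_mulId (a : Test) (x : ℝ) : dTest (mulId a) x = a x + x * dTest a x := by
  have h : HasDerivAt (mulId a) (1 * a x + x * dTest a x) x :=
    (hasDerivAt_id x).ofReal_comp.mul (hasDerivAt_test a x)
  rw [dTest_apply, h.deriv, one_mul]

theorem integrable_log_mul (a : Test) : Integrable fun x => (Real.log x : ℂ) * a x := by
  simpa using! locallyIntegrable_log.integrable_smul_right_of_hasCompactSupport a.continuous
    a.hasCompactSupport

/-- This is x · (ln|x|)' = 1 in weak form. The function x log x · a extends continuously through 0
and has derivative log x · (x a)' + a elsewhere, so the fundamental theorem of calculus with one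
exceptional point applies and no principal value is needed. -/
theorem integral_log_mul_deriv_mulId (a : Test) :
    ∫ x, (Real.log x : ℂ) * (a x + x * dTest a x) = -∫ x, a x := by
  obtain ⟨R, hR⟩ := exists_support_bound a
  obtain ⟨R', hR'⟩ := exists_support_bound (dTest a)
  set S := |R| + |R'| + 1
  have hS : ∀ x, S ≤ |x| → a x = 0 ∧ dTest a x = 0 := fun x hx =>
    ⟨hR x (by linarith [le_abs_self R, abs_nonneg R']),
      hR' x (by linarith [le_abs_self R', abs_nonneg R])⟩
  have hS0 : 0 ≤ S := by positivity
  have hai : Integrable a := a.continuous.integrable_of_hasCompactSupport a.hasCompactSupport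
  have h1 : Integrable fun x => (Real.log x : ℂ) * (a x + x * dTest a x) := by
    simpa only [dTest_mulId] using integrable_log_mul (dTest (mulId a))
  have hd : ∀ x : ℝ, x ≠ 0 → HasDerivAt (fun x : ℝ => ((x * Real.log x : ℝ) : ℂ) * a x)
      ((Real.log x : ℂ) * (a x + x * dTest a x) + a x) x := by
    intro x hx
    refine ((Real.hasDerivAt_mul_log hx).ofReal_comp.mul (hasDerivAt_test a x)).congr_deriv ?_
    push_cast
    ring
  have h2 := integral_eq_of_hasDerivAt_off_countable_of_le
    (fun x : ℝ => ((x * Real.log x : ℝ) : ℂ) * a x)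
    (fun x => (Real.log x : ℂ) * (a x + x * dTest a x) + a x) (a := -S) (b := S)
    (by linarith) (countable_singleton (0 : ℝ))
    ((Complex.continuous_ofReal.comp Real.continuous_mul_log).mul a.continuous).continuousOn
    (fun x hx => hd x hx.2) (h1.add hai).intervalIntegrable
  rw [intervalIntegral.integral_eq_integral_of_support_subset, (hS S (le_abs_self S)).1,
    (hS (-S) (by rw [abs_neg]; exact le_abs_self S)).1, integral_add h1 hai] at h2
  · simpa [add_eq_zero_iff_eq_neg] using h2
  · intro x hx
    by_contra h
    refine hx ?_
    have hx' : S ≤ |x| := by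
      by_contra h'
      have := abs_lt.mp (not_le.mp h')
      exact h ⟨this.1, this.2.le⟩
    simp [hS x hx']

/-- Multiplication by x acts on a convolution by the product rule x(v * a) = (xv) * a + v * (xa).
With v = (ln|x|)' one has xv = 1, so the defect is the constant ∫ a. -/
theorem mul_conv_log_dTest_sub (a : Test) (x : ℝ) :
    x * conv (ofFun fun x => (Real.log x : ℂ)) (dTest a) x
      - conv (ofFun fun x => (Real.log x : ℂ)) (dTest (mulId a)) x = ∫ y, a y := by
  have h := integral_log_mul_deriv_mulId (reflTranslate x a)
  have h0 : ∫ y, reflTranslate x a y = ∫ y, a y := integral_sub_left_eq_self a volume x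
  rw [h0] at h
  rw [conv_ofFun locallyIntegrable_log, conv_ofFun locallyIntegrable_log, ← neg_inj, ← h,
    ← integral_const_mul, ← integral_sub, ← integral_neg]
  · congr 1; funext y
    rw [dTest_mulId, dTest_reflTranslate]
    change _ = (Real.log y : ℂ) * (a (x - y) + y * -(dTest a (x - y)))
    push_cast
    ring
  · exact (integrable_log_mul (reflTranslate x (dTest a))).const_mul _
  · exact integrable_log_mul (reflTranslate x (dTest (mulId a)))

/-- Let I be the integral. Symmetry of the even kernel followed by integration by parts gives I =
-J, where J pairs the smoothing by (x a)' with a. The product rule `mul_conv_log_dTest_sub` gives J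
= I - (∫ a)² = I - 1. Hence 2I = 1, without any parity of a. -/
theorem integral_conv_log_dTest_mul_mulId {a : Test} (ha : ∫ x, a x = 1) :
    ∫ x, conv (ofFun fun x => (Real.log x : ℂ)) (dTest a) x * (x * a x) = 1 / 2 := by
  set u : Distr := ofFun fun x => (Real.log x : ℂ)
  have h1 : ∫ x, conv u (dTest a) x * mulId a x = -∫ x, conv u (dTest (mulId a)) x * a x := by
    rw [integral_conv_mul_comm locallyIntegrable_log (fun x => by simp) (dTest a) (mulId a),
      integral_deriv_mul_test (hasDerivAt_conv u (mulId a)) (by fun_prop), neg_neg]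
  have hi : Integrable fun x => conv u (dTest a) x * mulId a x :=
    integrable_mul_test (by fun_prop) _
  have hai : Integrable a := a.continuous.integrable_of_hasCompactSupport a.hasCompactSupport
  have h2 : ∫ x, conv u (dTest (mulId a)) x * a x = (∫ x, conv u (dTest a) x * mulId a x) - 1 := by
    rw [← ha, ← integral_sub hi hai]
    congr 1; funext x
    have := mul_conv_log_dTest_sub a x
    rw [ha] at this
    rw [mulId_apply]
    linear_combination (-a x) * this
  rw [h2] at h1
  simp only [mulId_apply] at h1
  linear_combination h1 / 2

/-! ### Products of convolutions tested against a test function -/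

/-- With H' = a one has a'H = (aH)' - a² and aH = (H²)'/2. The singular product is thus reduced to
the bounded H² and to a². -/
theorem integral_deriv_mul_conv_theta (a ψ : Test) :
    ∫ x, dTest a x * conv theta a x * ψ x
      = (1 / 2) * (∫ x, conv theta a x ^ 2 * dTest (dTest ψ) x) - ∫ x, a x * a x * ψ x := by
  have h1 := integral_deriv_mul_test
    (fun x => (hasDerivAt_test a x).mul (hasDerivAt_conv_theta a x)) (by fun_prop) ψ
  have h2 := integral_deriv_mul_test (fun x => (hasDerivAt_conv_theta a x).pow 2)
    (by fun_prop) (dTest ψ)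
  have e1 : ∫ x, (dTest a x * conv theta a x + a x * a x) * ψ x
      = (∫ x, dTest a x * conv theta a x * ψ x) + ∫ x, a x * a x * ψ x := by
    simp only [add_mul]
    exact integral_add (integrable_mul_test (by fun_prop) ψ) (integrable_mul_test (by fun_prop) ψ)
  have e2 : ∫ x, ((2 : ℕ) * conv theta a x ^ (2 - 1) * a x) * dTest ψ x
      = 2 * ∫ x, a x * conv theta a x * dTest ψ x := by
    rw [← integral_const_mul]
    congr 1; funext x
    push_cast
    ring
  simp only [Pi.mul_apply, Pi.pow_apply] at h1 h2
  rw [e1] at h1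
  rw [e2] at h2
  linear_combination h1 - h2 / 2

/-- Both derivatives are moved onto Hψ, and (Hψ)'' = Hψ'' + 2aψ' + a'ψ. The last term is the one
that the logarithmic product with δ' compensates. -/
theorem integral_conv_deriv_deriv_mul_conv_theta (u : Distr) (a ψ : Test) :
    ∫ x, conv u (dTest (dTest a)) x * conv theta a x * ψ x
      = (∫ x, conv u a x * (conv theta a x * dTest (dTest ψ) x))
        + 2 * (∫ x, conv u a x * a x * dTest ψ x) + ∫ x, conv u a x * dTest a x * ψ x := by
  have h1 := integral_deriv_mul_test
    (fun x => (hasDerivAt_conv u (dTest a) x).mul (hasDerivAt_conv_theta a x)) (by fun_prop) ψ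
  have h2 := integral_deriv_mul_test
    (fun x => (hasDerivAt_conv u a x).mul (hasDerivAt_test a x)) (by fun_prop) ψ
  have h3 := integral_deriv_mul_test
    (fun x => (hasDerivAt_conv u a x).mul (hasDerivAt_conv_theta a x)) (by fun_prop) (dTest ψ)
  simp only [Pi.mul_apply, add_mul] at h1 h2 h3
  rw [integral_add (integrable_mul_test (by fun_prop) _) (integrable_mul_test (by fun_prop) _)]
    at h1 h2 h3
  simp only [mul_assoc] at h1 h2 h3 ⊢
  linear_combination h1 - h2 - h3

/-! ### Concentrated mollifiers -/

/-- An even test function `d` with `∫ d = ∫ d² = 1`, supported in `[-lσ, lσ]` and bounded, together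
with its derivative, as a dilation by `σ` of a function of size `C`. -/
structure IsMollifier (l C σ : ℝ) (d : Test) : Prop where
  width_pos : 0 < l
  size_pos : 0 < C
  pos : 0 < σ
  even : ∀ x, d (-x) = d x
  integral_eq_one : ∫ x, d x = 1
  integral_sq : ∫ x, d x * d x = 1
  support : ∀ x, l * σ < |x| → d x = 0
  bound : ∀ x, ‖d x‖ ≤ C / σ
  deriv_bound : ∀ x, ‖dTest d x‖ ≤ C / σ ^ 2

theorem DeltaFamily.exists_isMollifier_net (D : DeltaFamily) :
    ∃ l C : ℝ, ∀ᶠ σ in 𝓝[>] (0 : ℝ), IsMollifier l C σ (D.net σ) := by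
  obtain ⟨l, hl⟩ := D.support_bound
  obtain ⟨C₀, h₀⟩ := D.deriv_bound 0
  obtain ⟨C₁, h₁⟩ := D.deriv_bound 1
  -- The absolute values and the added 1 make both constants positive, as `IsMollifier` requires;
  -- the given bounds carry no sign information.
  refine ⟨|l| + 1, |C₀| + |C₁| + 1, ?_⟩
  filter_upwards [self_mem_nhdsWithin, hl, h₀, h₁] with σ hσ hl h₀ h₁
  have hσ : 0 < σ := hσ
  have hσc : (σ : ℂ) ≠ 0 := by exact_mod_cast hσ.ne'
  refine ⟨by positivity, by positivity, hσ, fun x => ?_, ?_, ?_, fun x hx => ?_, fun x => ?_,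
    fun x => ?_⟩
  · rw [net, dilate_apply, dilate_apply, mul_neg, D.even σ hσ]
  · simp only [net, dilate_apply]
    rw [integral_const_mul, Measure.integral_comp_mul_left (fun x : ℝ => D.toFun σ x),
      D.integral_eq_one σ hσ, inv_inv, abs_of_pos hσ]
    simp [hσc]
  · have e : ∀ x, D.net σ x * D.net σ x = ((σ : ℂ)⁻¹ * (σ : ℂ)⁻¹) * D.toFun σ (σ⁻¹ * x) ^ 2 := by
      intro x
      rw [net, dilate_apply]
      ring
    -- Dilation gives ∫ D_σ² = σ⁻¹ ∫ D(σ, ·)². The factor 1/s in the definition of the family is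
    -- what makes this equal to 1 for every σ.
    have h := D.integral_sq σ hσ
    simp only [e]
    rw [integral_const_mul, Measure.integral_comp_mul_left (fun x : ℝ => D.toFun σ x ^ 2),
      inv_inv, abs_of_pos hσ, Complex.real_smul, ← h]
    field_simp
  · rw [net, dilate_apply, hl, mul_zero]
    rw [abs_mul, abs_of_pos (inv_pos.mpr hσ), lt_inv_mul_iff₀ hσ]
    nlinarith [le_abs_self l]
  · have := h₀ (σ⁻¹ * x)
    rw [iteratedDeriv_zero] at this
    rw [net, dilate_apply, norm_mul, norm_inv, Complex.norm_real, Real.norm_eq_abs,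
      abs_of_pos hσ, div_eq_inv_mul]
    refine mul_le_mul_of_nonneg_left ?_ (by positivity)
    linarith [le_abs_self C₀, abs_nonneg C₁]
  · rw [dTest_apply, ← iteratedDeriv_one, net, iteratedDeriv_dilate, norm_mul, norm_pow, norm_inv,
      Complex.norm_real, Real.norm_eq_abs, abs_of_pos hσ, div_eq_inv_mul, inv_pow]
    refine mul_le_mul_of_nonneg_left ?_ (by positivity)
    linarith [le_abs_self C₁, abs_nonneg C₀, h₁ (σ⁻¹ * x)]

theorem norm_integral_le_of_support {g : ℝ → ℂ} {r B : ℝ} (hr : 0 ≤ r)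
    (hs : ∀ x, r < |x| → g x = 0) (hB : ∀ x, |x| ≤ r → ‖g x‖ ≤ B) :
    ‖∫ x, g x‖ ≤ B * (2 * r) := by
  have h : ∫ x, g x = ∫ x in Icc (-r) r, g x := by
    refine (setIntegral_eq_integral_of_forall_compl_eq_zero fun x hx => hs x ?_).symm
    by_contra h
    exact hx (abs_le.mp (not_lt.mp h))
  rw [h]
  refine (norm_setIntegral_le_of_norm_le_const (s := Icc (-r) r) (by simp)
    fun x hx => hB x (abs_le.mpr ⟨hx.1, hx.2⟩)).trans ?_
  rw [Real.volume_real_Icc_of_le (by linarith)]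
  exact le_of_eq (by ring)

theorem conv_ofFun_eq_integral_sub {f : ℝ → ℂ} (hf : LocallyIntegrable f) (a : Test) (x : ℝ) :
    conv (ofFun f) a x = ∫ y, f (x - y) * a y := by
  rw [conv_ofFun hf, ← integral_sub_left_eq_self _ volume x]
  simp

/-- For |x| ≤ r only |y| ≤ 2r contributes. Keeping the integral of ‖f‖ over this shrinking interval
as a factor gives a gain over the size of the mollifier without any growth rate for f at 0. -/
theorem norm_conv_ofFun_le {f : ℝ → ℂ} (hf : LocallyIntegrable f) {a : Test} {r B x : ℝ}
    (hs : ∀ x, r < |x| → a x = 0) (hB : ∀ x, ‖a x‖ ≤ B) (hx : |x| ≤ r) :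
    ‖conv (ofFun f) a x‖ ≤ B * ∫ y in Icc (-(2 * r)) (2 * r), ‖f y‖ := by
  have hB0 : 0 ≤ B := (norm_nonneg _).trans (hB 0)
  have hI : IntegrableOn f (Icc (-(2 * r)) (2 * r)) := hf.integrableOn_isCompact isCompact_Icc
  rw [conv_ofFun hf, ← integral_const_mul]
  have h : ∫ y, f y * a (x - y) = ∫ y in Icc (-(2 * r)) (2 * r), f y * a (x - y) := by
    refine (setIntegral_eq_integral_of_forall_compl_eq_zero fun y hy => ?_).symm
    rw [hs, mul_zero]
    have h3 : 2 * r < |y| := by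
      by_contra h
      exact hy (abs_le.mp (not_lt.mp h))
    have := abs_sub_abs_le_abs_sub y x
    rw [abs_sub_comm] at this
    linarith
  rw [h]
  refine norm_integral_le_of_norm_le (hI.norm.const_mul B) (Eventually.of_forall fun y => ?_)
  rw [norm_mul, mul_comm]
  exact mul_le_mul_of_nonneg_right (hB _) (norm_nonneg _)

theorem tendsto_const_mul_nhdsGT_zero (c : ℝ) :
    Tendsto (fun σ : ℝ => c * σ) (𝓝[>] 0) (𝓝 0) := by
  have : Tendsto (fun σ : ℝ => c * σ) (𝓝 0) (𝓝 (c * 0)) := tendsto_id.const_mul c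
  rw [mul_zero] at this
  exact this.mono_left nhdsWithin_le_nhds

theorem tendsto_setIntegral_norm_Icc {f : ℝ → ℂ} (hf : LocallyIntegrable f) (c : ℝ) :
    Tendsto (fun σ : ℝ => ∫ y in Icc (-(c * σ)) (c * σ), ‖f y‖) (𝓝[>] 0) (𝓝 0) := by
  have hI : IntegrableOn f (Icc (-1) 1) := hf.integrableOn_isCompact isCompact_Icc
  have hc := tendsto_const_mul_nhdsGT_zero c
  -- Absolute continuity of the integral, applied on [-1, 1] because f is integrable only locally.
  have hm : Tendsto ((volume.restrict (Icc (-1 : ℝ) 1)) ∘ fun σ : ℝ => Icc (-(c * σ)) (c * σ))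
      (𝓝[>] 0) (𝓝 0) := by
    have h0 : Tendsto (fun σ : ℝ => ENNReal.ofReal (c * σ - -(c * σ))) (𝓝[>] 0) (𝓝 0) := by
      have := ENNReal.tendsto_ofReal (hc.sub hc.neg)
      simpa using this
    refine tendsto_of_tendsto_of_tendsto_of_le_of_le tendsto_const_nhds h0
      (fun _ => zero_le) fun σ => ?_
    exact (Measure.restrict_apply_le _ _).trans (by rw [Real.volume_Icc])
  refine (hI.norm.tendsto_setIntegral_nhds_zero hm).congr' ?_
  filter_upwards [hc.eventually (Ioo_mem_nhds (by norm_num : (-1 : ℝ) < 0) one_pos)] with σ hσ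
  rw [Measure.restrict_restrict measurableSet_Icc, inter_eq_left.mpr]
  exact Icc_subset_Icc (by linarith [hσ.2]) hσ.2.le

/-! ### Size, support and parity for a single mollifier -/

namespace IsMollifier

variable {l C σ : ℝ} {d : Test}

theorem radius_nonneg (h : IsMollifier l C σ d) : 0 ≤ l * σ :=
  (mul_pos h.width_pos h.pos).le

theorem deriv_support (h : IsMollifier l C σ d) {x : ℝ} (hx : l * σ < |x|) : dTest d x = 0 := by
  have : (d : ℝ → ℂ) =ᶠ[𝓝 x] fun _ => 0 := by
    filter_upwards [(isOpen_lt continuous_const continuous_abs).mem_nhds hx] with y hy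
    exact h.support y hy
  rw [dTest_apply, this.deriv_eq, deriv_const]

theorem deriv_odd (h : IsMollifier l C σ d) (x : ℝ) : dTest d (-x) = -dTest d x := by
  have : (fun x => d (-x)) = d := funext h.even
  rw [dTest_apply, dTest_apply, ← neg_neg (deriv d (-x)), ← deriv_comp_neg, this]

/-- The constant is (C/σ) times the length 2lσ of the support. Being independent of σ, it replaces ∫
|d| = 1, which may fail because d need not be nonnegative, or even real. -/
theorem norm_integral_mul_le (h : IsMollifier l C σ d) {g : ℝ → ℂ} {B : ℝ}
    (hB : ∀ x, |x| ≤ l * σ → ‖g x‖ ≤ B) : ‖∫ x, g x * d x‖ ≤ B * (2 * l * C) := by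
  have hσ := h.pos
  refine (norm_integral_le_of_support (r := l * σ) (B := B * (C / σ)) h.radius_nonneg
    (fun x hx => by rw [h.support x hx, mul_zero]) fun x hx => ?_).trans (le_of_eq ?_)
  · rw [norm_mul]
    exact mul_le_mul (hB x hx) (h.bound x) (norm_nonneg _) ((norm_nonneg _).trans (hB x hx))
  · field_simp

theorem norm_conv_le (h : IsMollifier l C σ d) {w : ℝ → ℂ} {B : ℝ} (hw : LocallyIntegrable w)
    (hB : ∀ x, ‖w x‖ ≤ B) (x : ℝ) : ‖conv (ofFun w) d x‖ ≤ B * (2 * l * C) := by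
  rw [conv_ofFun_eq_integral_sub hw]
  exact h.norm_integral_mul_le (g := fun y => w (x - y)) fun y _ => hB (x - y)

theorem conv_theta_of_lt (h : IsMollifier l C σ d) {x : ℝ} (hx : l * σ < |x|) :
    conv theta d x = thetaFun x := by
  have e : ∀ y, thetaFun (x - y) * d y = thetaFun x * d y := by
    intro y
    by_cases hy : l * σ < |y|
    · rw [h.support y hy, mul_zero, mul_zero]
    · have hy := abs_le.mp (not_lt.mp hy)
      rcases lt_abs.mp hx with hx | hx
      · rw [thetaFun, thetaFun, if_pos (by linarith), if_pos (by linarith [h.radius_nonneg])]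
      · rw [thetaFun, thetaFun, if_neg (by linarith), if_neg (by linarith [h.radius_nonneg])]
  rw [theta, conv_ofFun_eq_integral_sub locallyIntegrable_thetaFun]
  simp only [e]
  rw [integral_const_mul, h.integral_eq_one, mul_one]

theorem norm_conv_theta_le (h : IsMollifier l C σ d) (x : ℝ) : ‖conv theta d x‖ ≤ 2 * l * C := by
  have := h.norm_conv_le locallyIntegrable_thetaFun (B := 1)
    (fun x => by rw [thetaFun]; split_ifs <;> simp) x
  simpa using! this

theorem conv_odd (h : IsMollifier l C σ d) {f : ℝ → ℂ} (hf : LocallyIntegrable f)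
    (ho : ∀ x, f (-x) = -f x) (x : ℝ) : conv (ofFun f) d (-x) = -conv (ofFun f) d x := by
  rw [conv_ofFun hf, conv_ofFun hf, ← integral_neg, ← integral_neg_eq_self]
  congr 1; funext y
  rw [ho, ← h.even]
  ring_nf

theorem conv_deriv_odd (h : IsMollifier l C σ d) {f : ℝ → ℂ} (hf : LocallyIntegrable f)
    (he : ∀ x, f (-x) = f x) (x : ℝ) :
    conv (ofFun f) (dTest d) (-x) = -conv (ofFun f) (dTest d) x := by
  rw [conv_ofFun hf, conv_ofFun hf, ← integral_neg, ← integral_neg_eq_self]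
  congr 1; funext y
  rw [he, ← mul_neg, ← h.deriv_odd]
  ring_nf

end IsMollifier

/-! ### Limits along concentrating mollifiers -/

section Limits

variable {l C : ℝ} {d : ℝ → Test}

theorem tendsto_integral_mul_mollifier (hd : ∀ᶠ σ in 𝓝[>] (0 : ℝ), IsMollifier l C σ (d σ))
    {g : ℝ → ℂ} (hg : Continuous g) :
    Tendsto (fun σ => ∫ x, g x * d σ x) (𝓝[>] 0) (𝓝 (g 0)) := by
  obtain ⟨σ₀, h₀⟩ := hd.exists
  have hlC : 0 < 2 * l * C := mul_pos (mul_pos two_pos h₀.width_pos) h₀.size_pos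
  rw [Metric.tendsto_nhds]
  intro ε hε
  obtain ⟨δ, hδ, hgδ⟩ := Metric.continuousAt_iff.mp (hg.continuousAt (x := 0))
    (ε / 2 / (2 * l * C)) (by positivity)
  filter_upwards [hd, (tendsto_const_mul_nhdsGT_zero l).eventually (gt_mem_nhds hδ)] with σ h hσ
  have hi : Integrable (d σ) :=
    (d σ).continuous.integrable_of_hasCompactSupport (d σ).hasCompactSupport
  have e : (∫ x, g x * d σ x) - g 0 = ∫ x, (g x - g 0) * d σ x := by
    simp only [sub_mul]
    rw [integral_sub (integrable_mul_test hg _) (hi.const_mul _), integral_const_mul,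
      h.integral_eq_one, mul_one]
  rw [dist_eq_norm, e]
  refine (h.norm_integral_mul_le (B := ε / 2 / (2 * l * C)) fun x hx => ?_).trans_lt ?_
  · rw [← dist_eq_norm]
    refine (hgδ ?_).le
    rw [Real.dist_0_eq_abs]
    exact hx.trans_lt hσ
  · rw [div_mul_cancel₀ _ hlC.ne']
    exact half_lt_self hε

/-- Once 2lσ < |y|, every y - z with |z| ≤ lσ has the sign of y and lies beyond the radius lσ, where
the smoothed step is exact. -/
theorem eventually_conv_theta_eq (hd : ∀ᶠ σ in 𝓝[>] (0 : ℝ), IsMollifier l C σ (d σ))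
    {y : ℝ} (hy : y ≠ 0) :
    ∀ᶠ σ in 𝓝[>] (0 : ℝ), ∀ z, |z| ≤ l * σ → conv theta (d σ) (y - z) = thetaFun y := by
  filter_upwards [hd, (tendsto_const_mul_nhdsGT_zero (2 * l)).eventually
    (gt_mem_nhds (abs_pos.mpr hy))] with σ h hσ z hz
  have hr := h.radius_nonneg
  have hz' := abs_le.mp hz
  rw [h.conv_theta_of_lt]
  · rcases lt_abs.mp hσ with hσ | hσ
    · rw [thetaFun, thetaFun, if_pos (by linarith), if_pos (by linarith)]
    · rw [thetaFun, thetaFun, if_neg (by linarith), if_neg (by linarith)]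
  · have := abs_sub_abs_le_abs_sub y z
    linarith

theorem tendsto_integral_conv_mul_conv_theta
    (hd : ∀ᶠ σ in 𝓝[>] (0 : ℝ), IsMollifier l C σ (d σ)) {f : ℝ → ℂ} (hf : LocallyIntegrable f)
    (χ : Test) :
    Tendsto (fun σ => ∫ x, conv (ofFun f) (d σ) x * (conv theta (d σ) x * χ x)) (𝓝[>] 0)
      (𝓝 (∫ x, f x * (thetaFun x * χ x))) := by
  obtain ⟨σ₀, h₀⟩ := hd.exists
  have hlC : 0 < 2 * l * C := mul_pos (mul_pos two_pos h₀.width_pos) h₀.size_pos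
  obtain ⟨R, hR⟩ := exists_support_bound χ
  obtain ⟨B, hB⟩ := χ.continuous.bounded_above_of_compact_support χ.hasCompactSupport
  have hB0 : 0 ≤ B := (norm_nonneg _).trans (hB 0)
  have hwc : ∀ σ, Continuous fun x => conv theta (d σ) x * χ x := fun σ => by fun_prop
  have hw : ∀ σ, LocallyIntegrable fun x => conv theta (d σ) x * χ x :=
    fun σ => (hwc σ).locallyIntegrable
  -- Evenness of d lets the convolution pass from f to Hχ. The possibly unbounded f then appears
  -- unsmoothed and can serve as majorant in dominated convergence.
  have e : ∀ᶠ σ in 𝓝[>] (0 : ℝ),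
      ∫ y, f y * conv (ofFun fun x => conv theta (d σ) x * χ x) (d σ) y
        = ∫ x, conv (ofFun f) (d σ) x * (conv theta (d σ) x * χ x) := by
    filter_upwards [hd] with σ h
    rw [integral_conv_mul hf (d σ) (hwc σ) χ.hasCompactSupport.mul_left]
    congr 1; funext y
    rw [conv_ofFun (hw σ)]
    congr 2; funext x
    rw [mul_comm, ← h.even, neg_sub]
  refine Tendsto.congr' e ?_
  set K := Icc (-(R + l)) (R + l)
  refine tendsto_integral_filter_of_dominated_convergence
    -- One factor 2lC bounds the smoothed step, the other the convolution with d. The interval K is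
    -- enlarged by l only, since σ ≤ 1 eventually.
    (fun y => K.indicator (fun y => ‖f y‖) y * (2 * l * C * B * (2 * l * C))) ?_ ?_ ?_ ?_
  · exact Eventually.of_forall fun σ =>
      hf.aestronglyMeasurable.mul (continuous_conv _ _).aestronglyMeasurable
  · filter_upwards [hd, eventually_Ioc] with σ h hσ
    refine Eventually.of_forall fun y => ?_
    by_cases hy : y ∈ K
    · rw [indicator_of_mem hy, norm_mul]
      refine mul_le_mul_of_nonneg_left (h.norm_conv_le (hw σ) (fun x => ?_) y) (norm_nonneg _)
      rw [norm_mul]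
      exact mul_le_mul (h.norm_conv_theta_le x) (hB x) (norm_nonneg _) hlC.le
    · rw [indicator_of_notMem hy, conv_ofFun_eq_integral_sub (hw σ), zero_mul]
      have : ∀ z, conv theta (d σ) (y - z) * χ (y - z) * d σ z = 0 := by
        intro z
        by_cases hz : l * σ < |z|
        · rw [h.support z hz, mul_zero]
        · have h3 : R + l < |y| := by
            by_contra h
            exact hy (abs_le.mp (not_lt.mp h))
          have h4 := abs_sub_abs_le_abs_sub y z
          have h5 : l * σ ≤ l := mul_le_of_le_one_right h₀.width_pos.le hσ.2
          rw [hR (y - z) (by linarith)]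
          ring
      simp [this]
  · have hK : IntegrableOn (fun y => ‖f y‖) K := (hf.integrableOn_isCompact isCompact_Icc).norm
    exact (hK.integrable_indicator measurableSet_Icc).mul_const _
  · have hae : ∀ᵐ y : ℝ, y ≠ 0 := by simp [ae_iff]
    filter_upwards [hae] with y hy
    refine Tendsto.const_mul _ ?_
    have h1 := (tendsto_integral_mul_mollifier hd (g := fun z => χ (y - z)) (by fun_prop)).const_mul
      (thetaFun y)
    rw [sub_zero] at h1
    refine h1.congr' ?_
    filter_upwards [hd, eventually_conv_theta_eq hd hy] with σ h hσ
    rw [conv_ofFun_eq_integral_sub (hw σ), ← integral_const_mul]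
    congr 1; funext z
    by_cases hz : l * σ < |z|
    · rw [h.support z hz]; ring
    · rw [hσ z (not_lt.mp hz)]; ring

/-- H is uniformly bounded and eventually equals θ at each nonzero point, and θ² = θ. -/
theorem tendsto_integral_conv_theta_sq
    (hd : ∀ᶠ σ in 𝓝[>] (0 : ℝ), IsMollifier l C σ (d σ)) (χ : Test) :
    Tendsto (fun σ => ∫ x, conv theta (d σ) x ^ 2 * χ x) (𝓝[>] 0) (𝓝 (theta χ)) := by
  rw [theta_apply]
  have hχ : Integrable χ := χ.continuous.integrable_of_hasCompactSupport χ.hasCompactSupport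
  refine tendsto_integral_filter_of_dominated_convergence
    (fun x => (2 * l * C) ^ 2 * ‖χ x‖) ?_ ?_ (hχ.norm.const_mul _) ?_
  · exact Eventually.of_forall fun σ =>
      (by fun_prop : Continuous fun x => conv theta (d σ) x ^ 2 * χ x).aestronglyMeasurable
  · filter_upwards [hd] with σ h
    refine Eventually.of_forall fun x => ?_
    rw [norm_mul, norm_pow]
    gcongr
    exact h.norm_conv_theta_le x
  · have hae : ∀ᵐ y : ℝ, y ≠ 0 := by simp [ae_iff]
    filter_upwards [hae] with y hy
    refine tendsto_const_nhds.congr' ?_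
    filter_upwards [hd, eventually_conv_theta_eq hd hy] with σ h hσ
    have := hσ 0 (by simpa using h.radius_nonneg)
    rw [sub_zero] at this
    rw [this, thetaFun]
    split_ifs <;> simp

/-- On the support |x| ≤ lσ the first-order Taylor remainder of χ is O(σ²), so it is harmless as
soon as G = o(σ⁻²) uniformly there. What survives are the moments of order 0 and 1 of G d, which the
applications compute by parity or by exact identities. -/
theorem tendsto_integral_mul_mollifier_mul_sub_taylor
    (hd : ∀ᶠ σ in 𝓝[>] (0 : ℝ), IsMollifier l C σ (d σ)) {G : ℝ → ℝ → ℂ} {K : ℝ → ℝ}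
    (hG : ∀ σ, Continuous (G σ)) (hK : Tendsto K (𝓝[>] 0) (𝓝 0))
    (hGK : ∀ᶠ σ in 𝓝[>] (0 : ℝ), ∀ x, |x| ≤ l * σ → ‖G σ x‖ * σ ^ 2 ≤ K σ) (χ : Test) :
    Tendsto (fun σ => (∫ x, G σ x * d σ x * χ x) - (χ 0 * (∫ x, G σ x * d σ x)
      + dTest χ 0 * ∫ x, G σ x * (x * d σ x))) (𝓝[>] 0) (𝓝 0) := by
  obtain ⟨M, hM⟩ := exists_iteratedDeriv_bound χ 2
  have hM0 : 0 ≤ M := (norm_nonneg _).trans (hM 0)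
  have hρ : ∀ x : ℝ, ‖χ x - χ 0 - x * dTest χ 0‖ ≤ M * |x| ^ 2 := by
    intro x
    have := taylor_bound χ.contDiff (M := M)
      (fun z => by rw [← iteratedDeriv_one, ← iteratedDeriv_succ']; exact hM z) 0 x
    rw [dTest_apply]
    simpa using this
  have hlim : Tendsto (fun σ => K σ * (M * l ^ 2) * (2 * l * C)) (𝓝[>] 0) (𝓝 0) := by
    have := (hK.mul_const (M * l ^ 2)).mul_const (2 * l * C)
    simpa using this
  refine squeeze_zero_norm' ?_ hlim
  filter_upwards [hd, hGK] with σ h hσ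
  have i1 : Integrable fun x => G σ x * χ x * d σ x :=
    integrable_mul_test ((hG σ).mul χ.continuous) _
  have i2 : Integrable fun x => G σ x * d σ x := integrable_mul_test (hG σ) _
  have i3 : Integrable fun x => G σ x * (x * d σ x) := integrable_mul_test (hG σ) (mulId (d σ))
  have i4 : Integrable fun x => G σ x * χ x * d σ x - χ 0 * (G σ x * d σ x) :=
    i1.sub (i2.const_mul _)
  have e : (∫ x, G σ x * d σ x * χ x) - (χ 0 * (∫ x, G σ x * d σ x)
      + dTest χ 0 * ∫ x, G σ x * (x * d σ x))
      = ∫ x, (G σ x * (χ x - χ 0 - x * dTest χ 0)) * d σ x := by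
    simp only [mul_right_comm _ (d σ _) (χ _)]
    rw [← integral_const_mul, ← integral_const_mul, ← sub_sub, ← integral_sub i1 (i2.const_mul _),
      ← integral_sub i4 (i3.const_mul _)]
    congr 1; funext x
    ring
  rw [e]
  refine h.norm_integral_mul_le fun x hx => ?_
  have hx2 : |x| ^ 2 ≤ (l * σ) ^ 2 := pow_le_pow_left₀ (abs_nonneg x) hx 2
  rw [norm_mul]
  calc ‖G σ x‖ * ‖χ x - χ 0 - x * dTest χ 0‖ ≤ ‖G σ x‖ * (M * (l * σ) ^ 2) :=
        mul_le_mul_of_nonneg_left ((hρ x).trans (mul_le_mul_of_nonneg_left hx2 hM0))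
          (norm_nonneg _)
    _ = ‖G σ x‖ * σ ^ 2 * (M * l ^ 2) := by ring
    _ ≤ K σ * (M * l ^ 2) := mul_le_mul_of_nonneg_right (hσ x hx) (by positivity)

theorem tendsto_integral_mollifier_sq
    (hd : ∀ᶠ σ in 𝓝[>] (0 : ℝ), IsMollifier l C σ (d σ)) (χ : Test) :
    Tendsto (fun σ => ∫ x, d σ x * d σ x * χ x) (𝓝[>] 0) (𝓝 (χ 0)) := by
  have h := (tendsto_integral_mul_mollifier_mul_sub_taylor hd (G := fun σ => d σ)
    (fun σ => (d σ).continuous) (tendsto_const_mul_nhdsGT_zero C) ?_ χ).add_const (χ 0)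
  · rw [zero_add] at h
    refine h.congr' ?_
    filter_upwards [hd] with σ h
    -- The first moment of the even function d² vanishes; its integral is 1 by normalisation.
    have : ∫ x, d σ x * (x * d σ x) = 0 := integral_eq_zero_of_odd fun x => by
      rw [h.even]; push_cast; ring
    rw [this, h.integral_sq]
    ring
  · filter_upwards [hd] with σ h x _
    have hσ := h.pos
    calc ‖d σ x‖ * σ ^ 2 ≤ C / σ * σ ^ 2 := mul_le_mul_of_nonneg_right (h.bound x) (by positivity)
      _ = C * σ := by field_simp

/-- The smoothing of f is odd, so its product with d has integral 0. The first moment has an even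
integrand and is not killed by parity; it tends to 0 because the smoothing is o(1/σ) on the support
of d, while |x| ≤ lσ. -/
theorem tendsto_integral_conv_odd_mul_mollifier
    (hd : ∀ᶠ σ in 𝓝[>] (0 : ℝ), IsMollifier l C σ (d σ)) {f : ℝ → ℂ} (hf : LocallyIntegrable f)
    (ho : ∀ x, f (-x) = -f x) (χ : Test) :
    Tendsto (fun σ => ∫ x, conv (ofFun f) (d σ) x * d σ x * χ x) (𝓝[>] 0) (𝓝 0) := by
  set I : ℝ → ℝ := fun σ => ∫ y in Icc (-(2 * l * σ)) (2 * l * σ), ‖f y‖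
  have hI : Tendsto I (𝓝[>] 0) (𝓝 0) := tendsto_setIntegral_norm_Icc hf (2 * l)
  have hb : ∀ᶠ σ in 𝓝[>] (0 : ℝ), ∀ x, |x| ≤ l * σ → ‖conv (ofFun f) (d σ) x‖ * σ ≤ C * I σ := by
    filter_upwards [hd] with σ h x hx
    have hσ := h.pos
    have := norm_conv_ofFun_le hf h.support h.bound hx
    rw [← mul_assoc] at this
    calc ‖conv (ofFun f) (d σ) x‖ * σ ≤ C / σ * I σ * σ := mul_le_mul_of_nonneg_right this hσ.le
      _ = C * I σ := by field_simp
  have h1 : Tendsto (fun σ => ∫ x, conv (ofFun f) (d σ) x * (x * d σ x)) (𝓝[>] 0) (𝓝 0) := by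
    have hlim : Tendsto (fun σ => C * I σ * l * (2 * l * C)) (𝓝[>] 0) (𝓝 0) := by
      have := ((hI.const_mul C).mul_const l).mul_const (2 * l * C)
      simpa using this
    refine squeeze_zero_norm' ?_ hlim
    filter_upwards [hd, hb] with σ h hσ
    simp only [← mul_assoc (conv _ _ _)]
    refine h.norm_integral_mul_le fun x hx => ?_
    rw [norm_mul, Complex.norm_real, Real.norm_eq_abs]
    calc ‖conv (ofFun f) (d σ) x‖ * |x| ≤ ‖conv (ofFun f) (d σ) x‖ * (l * σ) :=
          mul_le_mul_of_nonneg_left hx (norm_nonneg _)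
      _ = ‖conv (ofFun f) (d σ) x‖ * σ * l := by ring
      _ ≤ C * I σ * l := mul_le_mul_of_nonneg_right (hσ x hx) h.width_pos.le
  have h2 := (tendsto_integral_mul_mollifier_mul_sub_taylor hd (K := fun σ => C * I σ)
    (G := fun σ => conv (ofFun f) (d σ)) (fun σ => by fun_prop)
    (by simpa using hI.const_mul C) ?_ χ).add (h1.const_mul (dTest χ 0))
  · rw [mul_zero, add_zero] at h2
    refine h2.congr' ?_
    filter_upwards [hd] with σ h
    have : ∫ x, conv (ofFun f) (d σ) x * d σ x = 0 := integral_eq_zero_of_odd fun x => by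
      rw [h.even, h.conv_odd hf ho]; ring
    rw [this]
    ring
  · filter_upwards [hb, eventually_Ioc] with σ hσ h1 x hx
    refine le_trans ?_ (hσ x hx)
    -- The bound is already known with one power of σ; σ² ≤ σ for σ ≤ 1.
    exact mul_le_mul_of_nonneg_left (pow_le_of_le_one h1.1.le h1.2 two_ne_zero) (norm_nonneg _)

/-- Differentiating the even logarithm makes the smoothing odd, so the zeroth moment vanishes, and
the first moment is 1/2 for every σ. The size o(σ⁻²) needed for the Taylor remainder comes from the
derivative bound on d. -/
theorem tendsto_integral_conv_log_dTest_mul_mollifier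
    (hd : ∀ᶠ σ in 𝓝[>] (0 : ℝ), IsMollifier l C σ (d σ)) (χ : Test) :
    Tendsto (fun σ => ∫ x, conv (ofFun fun x => (Real.log x : ℂ)) (dTest (d σ)) x * d σ x * χ x)
      (𝓝[>] 0) (𝓝 (1 / 2 * dTest χ 0)) := by
  set f : ℝ → ℂ := fun x => (Real.log x : ℂ)
  set I : ℝ → ℝ := fun σ => ∫ y in Icc (-(2 * l * σ)) (2 * l * σ), ‖f y‖
  have hI : Tendsto I (𝓝[>] 0) (𝓝 0) := tendsto_setIntegral_norm_Icc locallyIntegrable_log (2 * l)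
  have h2 := (tendsto_integral_mul_mollifier_mul_sub_taylor hd (K := fun σ => C * I σ)
    (G := fun σ => conv (ofFun f) (dTest (d σ))) (fun σ => by fun_prop)
    (by simpa using hI.const_mul C) ?_ χ).add_const (1 / 2 * dTest χ 0)
  · rw [zero_add] at h2
    refine h2.congr' ?_
    filter_upwards [hd] with σ h
    have : ∫ x, conv (ofFun f) (dTest (d σ)) x * d σ x = 0 := integral_eq_zero_of_odd fun x => by
      rw [h.even, h.conv_deriv_odd locallyIntegrable_log (fun x => by simp)]; ring
    rw [this, integral_conv_log_dTest_mul_mulId h.integral_eq_one]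
    ring
  · filter_upwards [hd] with σ h x hx
    have hσ := h.pos
    have := norm_conv_ofFun_le locallyIntegrable_log (fun x => h.deriv_support) h.deriv_bound hx
    rw [← mul_assoc] at this
    calc ‖conv (ofFun f) (dTest (d σ)) x‖ * σ ^ 2 ≤ C / σ ^ 2 * I σ * σ ^ 2 :=
          mul_le_mul_of_nonneg_right this (by positivity)
      _ = C * I σ := by field_simp

end Limits

/-! ### The singular distributions and their models -/

theorem xPlusNegSucc_one : xPlusNegSucc 1 = -pd (pd lnPlus) - pd delta := by
  have h : (-1 : ℂ) ^ 1 / (1).factorial = -1 := by simp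
  have h' : (-1 : ℂ) ^ 1 * (harmonic 1 : ℂ) / (1).factorial = -1 := by simp [harmonic]
  rw [xPlusNegSucc, h, h']
  ext ψ
  change -1 * pd (pd lnPlus) ψ + -1 * pd delta ψ = -pd (pd lnPlus) ψ - pd delta ψ
  ring

theorem xMinusNegSucc_one : xMinusNegSucc 1 = -pd (pd lnMinus) + pd delta := by
  have h : (-1 : ℂ) / (1).factorial = -1 := by simp
  have h' : (harmonic 1 : ℂ) / (1).factorial = 1 := by simp [harmonic]
  rw [xMinusNegSucc, h, h']
  ext ψ
  change -1 * pd (pd lnMinus) ψ + 1 * pd delta ψ = -pd (pd lnMinus) ψ + pd delta ψ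
  ring

theorem xNegSuccSgn_one :
    xNegSuccSgn 1 = -(pd (pd lnPlus) - pd (pd lnMinus)) - (2 : ℂ) • pd delta := by
  rw [xNegSuccSgn, xPlusNegSucc_one, xMinusNegSucc_one]
  ext ψ
  change -pd (pd lnPlus) ψ - pd delta ψ - (-1 : ℂ) ^ (1 + 1) * (-pd (pd lnMinus) ψ + pd delta ψ)
    = -(pd (pd lnPlus) ψ - pd (pd lnMinus) ψ) - 2 * pd delta ψ
  ring

theorem locallyIntegrable_lnPlusFun_sub_lnMinusFun :
    LocallyIntegrable fun x => lnPlusFun x - lnMinusFun x :=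
  locallyIntegrable_lnPlusFun.sub locallyIntegrable_lnMinusFun

theorem lnAbsSgn_eq_ofFun : lnAbsSgn = ofFun fun x => lnPlusFun x - lnMinusFun x := by
  ext ψ
  rw [ofFun_apply locallyIntegrable_lnPlusFun_sub_lnMinusFun]
  change lnPlus ψ - lnMinus ψ = _
  rw [lnPlus, lnMinus, ofFun_apply locallyIntegrable_lnPlusFun,
    ofFun_apply locallyIntegrable_lnMinusFun]
  simp only [sub_mul]
  refine (integral_sub ?_ ?_).symm
  · simpa using! locallyIntegrable_lnPlusFun.integrable_smul_right_of_hasCompactSupport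
      ψ.continuous ψ.hasCompactSupport
  · simpa using! locallyIntegrable_lnMinusFun.integrable_smul_right_of_hasCompactSupport
      ψ.continuous ψ.hasCompactSupport

theorem lnPlusFun_add_lnMinusFun (x : ℝ) : lnPlusFun x + lnMinusFun x = (Real.log x : ℂ) := by
  rcases lt_trichotomy x 0 with h | rfl | h
  · simp [lnPlusFun, lnMinusFun, h, h.not_gt]
  · simp [lnPlusFun, lnMinusFun]
  · simp [lnPlusFun, lnMinusFun, h, h.not_gt]

theorem lnPlus_add_lnMinus : lnPlus + lnMinus = ofFun fun x => (Real.log x : ℂ) := by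
  ext ψ
  rw [ofFun_apply locallyIntegrable_log]
  change lnPlus ψ + lnMinus ψ = _
  rw [lnPlus, lnMinus, ofFun_apply locallyIntegrable_lnPlusFun,
    ofFun_apply locallyIntegrable_lnMinusFun]
  simp only [← lnPlusFun_add_lnMinusFun, add_mul]
  refine (integral_add ?_ ?_).symm
  · simpa using! locallyIntegrable_lnPlusFun.integrable_smul_right_of_hasCompactSupport
      ψ.continuous ψ.hasCompactSupport
  · simpa using! locallyIntegrable_lnMinusFun.integrable_smul_right_of_hasCompactSupport
      ψ.continuous ψ.hasCompactSupport

theorem lnPlusFun_neg (x : ℝ) : lnPlusFun (-x) = lnMinusFun x := by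
  simp [lnPlusFun, lnMinusFun]

theorem lnMinusFun_neg (x : ℝ) : lnMinusFun (-x) = lnPlusFun x := by
  simp [lnPlusFun, lnMinusFun]

theorem lnPlusFun_mul_thetaFun (x : ℝ) (z : ℂ) :
    lnPlusFun x * (thetaFun x * z) = lnPlusFun x * z := by
  rw [lnPlusFun, thetaFun]
  split_ifs <;> simp

theorem lnMinusFun_mul_thetaFun (x : ℝ) (z : ℂ) : lnMinusFun x * (thetaFun x * z) = 0 := by
  rw [lnMinusFun, thetaFun]
  split_ifs with h h'
  · exact absurd h' h.not_gt
  all_goals simp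

theorem conv_xPlusNegSucc_one (a : Test) (x : ℝ) :
    conv (xPlusNegSucc 1) a x = -conv lnPlus (dTest (dTest a)) x - dTest a x := by
  rw [xPlusNegSucc_one]
  change -conv (pd (pd lnPlus)) a x - conv (pd delta) a x = _
  rw [conv_pd, conv_pd, conv_pd, conv_delta]

theorem conv_xNegSuccSgn_one (a : Test) (x : ℝ) :
    conv (xNegSuccSgn 1) a x = -conv lnAbsSgn (dTest (dTest a)) x - 2 * dTest a x := by
  rw [xNegSuccSgn_one]
  change -(conv (pd (pd lnPlus)) a x - conv (pd (pd lnMinus)) a x) - 2 * conv (pd delta) a x = _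
  rw [conv_pd, conv_pd, conv_pd, conv_pd, conv_pd, conv_delta]
  rfl

theorem theta_dTest (ψ : Test) : theta (dTest ψ) = -ψ 0 := by
  have := pd_apply theta ψ
  rw [pd_theta, delta_apply] at this
  rw [this, neg_neg]

theorem xPlusNegSucc_one_apply (ψ : Test) :
    xPlusNegSucc 1 ψ = -(∫ x, lnPlusFun x * dTest (dTest ψ) x) + dTest ψ 0 := by
  rw [xPlusNegSucc_one]
  change -pd (pd lnPlus) ψ - pd delta ψ = _
  rw [pd_apply, pd_apply, pd_apply, delta_apply, neg_neg, lnPlus,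
    ofFun_apply locallyIntegrable_lnPlusFun, sub_neg_eq_add]

/-! ### The two products tested against ψ, with the divergent terms cancelled -/

theorem integral_xNegSuccSgn_product (a ψ : Test) :
    ∫ x, (conv (xNegSuccSgn 1) a x * conv theta a x + conv lnAbsSgn a x * conv (pd delta) a x) * ψ x
      = -(∫ x, conv lnAbsSgn a x * (conv theta a x * dTest (dTest ψ) x))
        - 2 * (∫ x, conv lnAbsSgn a x * a x * dTest ψ x)
        - (∫ x, conv theta a x ^ 2 * dTest (dTest ψ) x) + 2 * ∫ x, a x * a x * ψ x := by
  have i1 : Integrable fun x => conv lnAbsSgn (dTest (dTest a)) x * conv theta a x * ψ x :=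
    integrable_mul_test (by fun_prop) ψ
  have i2 : Integrable fun x => dTest a x * conv theta a x * ψ x :=
    integrable_mul_test (by fun_prop) ψ
  have i3 : Integrable fun x => conv lnAbsSgn a x * dTest a x * ψ x :=
    integrable_mul_test (by fun_prop) ψ
  have i4 : Integrable fun x => conv lnAbsSgn (dTest (dTest a)) x * conv theta a x * ψ x
      + 2 * (dTest a x * conv theta a x * ψ x) := i1.add (i2.const_mul 2)
  have e : ∀ x, (conv (xNegSuccSgn 1) a x * conv theta a x
      + conv lnAbsSgn a x * conv (pd delta) a x) * ψ x
      = conv lnAbsSgn a x * dTest a x * ψ x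
        - (conv lnAbsSgn (dTest (dTest a)) x * conv theta a x * ψ x
          + 2 * (dTest a x * conv theta a x * ψ x)) := by
    intro x
    rw [conv_xNegSuccSgn_one, conv_pd, conv_delta]
    ring
  simp only [e]
  rw [integral_sub i3 i4, integral_add i1 (i2.const_mul 2),
    integral_const_mul, integral_conv_deriv_deriv_mul_conv_theta, integral_deriv_mul_conv_theta]
  ring

theorem integral_xPlusNegSucc_product (a ψ : Test) :
    ∫ x, (conv (xPlusNegSucc 1) a x * conv theta a x - conv lnMinus a x * conv (pd delta) a x) * ψ x
      = -(∫ x, conv lnPlus a x * (conv theta a x * dTest (dTest ψ) x))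
        - (∫ x, conv lnAbsSgn a x * a x * dTest ψ x)
        + (∫ x, conv (ofFun fun x => (Real.log x : ℂ)) (dTest a) x * a x * ψ x)
        - (1 / 2) * (∫ x, conv theta a x ^ 2 * dTest (dTest ψ) x) + ∫ x, a x * a x * ψ x := by
  have i1 : Integrable fun x => conv lnPlus (dTest (dTest a)) x * conv theta a x * ψ x :=
    integrable_mul_test (by fun_prop) ψ
  have i2 : Integrable fun x => dTest a x * conv theta a x * ψ x :=
    integrable_mul_test (by fun_prop) ψ
  have i3 : ∀ u, Integrable fun x => conv u a x * dTest a x * ψ x := fun u =>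
    integrable_mul_test (by fun_prop) ψ
  have i4 : ∀ u, Integrable fun x => conv u a x * a x * dTest ψ x := fun u =>
    integrable_mul_test (by fun_prop) (dTest ψ)
  have i5 : Integrable fun x => -(conv lnPlus (dTest (dTest a)) x * conv theta a x * ψ x
      + dTest a x * conv theta a x * ψ x) := (i1.add i2).neg
  have e : ∀ x, (conv (xPlusNegSucc 1) a x * conv theta a x
      - conv lnMinus a x * conv (pd delta) a x) * ψ x
      = -(conv lnPlus (dTest (dTest a)) x * conv theta a x * ψ x
        + dTest a x * conv theta a x * ψ x) - conv lnMinus a x * dTest a x * ψ x := by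
    intro x
    rw [conv_xPlusNegSucc_one, conv_pd, conv_delta]
    ring
  -- The terms in L₊ a' and L₋ a' enter with the same sign and add up to the smoothing of ln|x|
  -- times a'; this integration by parts takes the derivative off a.
  have h := integral_deriv_mul_test (fun x =>
    (hasDerivAt_conv (lnPlus + lnMinus) a x).mul (hasDerivAt_test a x)) (by fun_prop) ψ
  simp only [Pi.mul_apply, add_mul] at h
  rw [integral_add (integrable_mul_test (by fun_prop) _) (i3 _)] at h
  have h1 : ∫ x, conv (lnPlus + lnMinus) a x * dTest a x * ψ x
      = (∫ x, conv lnPlus a x * dTest a x * ψ x) + ∫ x, conv lnMinus a x * dTest a x * ψ x := by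
    rw [← integral_add (i3 _) (i3 _)]
    simp only [← add_mul]
    rfl
  have h2 : ∫ x, conv (lnPlus + lnMinus) a x * a x * dTest ψ x
      = (∫ x, conv lnPlus a x * a x * dTest ψ x) + ∫ x, conv lnMinus a x * a x * dTest ψ x := by
    rw [← integral_add (i4 _) (i4 _)]
    simp only [← add_mul]
    rfl
  have h3 : ∫ x, conv lnAbsSgn a x * a x * dTest ψ x
      = (∫ x, conv lnPlus a x * a x * dTest ψ x) - ∫ x, conv lnMinus a x * a x * dTest ψ x := by
    rw [← integral_sub (i4 _) (i4 _)]
    simp only [← sub_mul]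
    rfl
  rw [h1, h2, lnPlus_add_lnMinus] at h
  simp only [e]
  rw [integral_sub i5 (i3 _), integral_neg, integral_add i1 i2,
    integral_conv_deriv_deriv_mul_conv_theta, integral_deriv_mul_conv_theta, h3]
  linear_combination -h

/-! ### From limits in σ to association -/

/-- The representative sees φ only through its size, and the size of φ_ε is ε s(φ). The limit ε → 0
is therefore the limit σ → 0 along a rescaling, and no vanishing moments are needed: q = 0 works for
every ψ. -/
theorem DeltaFamily.associatedWith_of_tendsto (D : DeltaFamily) (f : moderate)
    (P : Test → ℝ → ℂ) (hP : ∀ φ, f.1 φ = P (D.net (size φ.1))) (u : Distr)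
    (h : ∀ ψ : Test,
      Tendsto (fun σ : ℝ => ∫ x, P (D.net σ) x * ψ x) (𝓝[>] 0) (𝓝 (u ψ))) :
    AssociatedWith (Ideal.Quotient.mk nullIdeal f) u := by
  refine ⟨f, rfl, fun ψ => ⟨0, fun φ _ => ?_⟩⟩
  have hs := size_pos φ
  have ht : Tendsto (fun ε : ℝ => size φ.1 * ε) (𝓝[>] 0) (𝓝[>] 0) := by
    refine tendsto_nhdsWithin_iff.mpr ⟨tendsto_const_mul_nhdsGT_zero _, ?_⟩
    filter_upwards [self_mem_nhdsWithin] with ε hε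
    exact mul_pos hs hε
  refine ((h ψ).comp ht).congr' ?_
  filter_upwards [self_mem_nhdsWithin] with ε hε
  have hε : 0 < ε := hε
  rw [Function.comp_apply, hP, scale, dif_pos hε, size_dilate hε, mul_comm]

namespace DeltaFamily

variable (D : DeltaFamily)

theorem tendsto_integral_conv_theta_sq_net (ψ : Test) :
    Tendsto (fun σ => ∫ x, conv theta (D.net σ) x ^ 2 * dTest (dTest ψ) x) (𝓝[>] 0)
      (𝓝 (-dTest ψ 0)) := by
  obtain ⟨l, C, hd⟩ := D.exists_isMollifier_net
  simpa only [theta_dTest] using tendsto_integral_conv_theta_sq hd (dTest (dTest ψ))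

theorem tendsto_integral_conv_lnAbsSgn_mul_net (ψ : Test) :
    Tendsto (fun σ => ∫ x, conv lnAbsSgn (D.net σ) x * D.net σ x * ψ x) (𝓝[>] 0) (𝓝 0) := by
  obtain ⟨l, C, hd⟩ := D.exists_isMollifier_net
  rw [lnAbsSgn_eq_ofFun]
  refine tendsto_integral_conv_odd_mul_mollifier hd locallyIntegrable_lnPlusFun_sub_lnMinusFun
    (fun x => ?_) ψ
  rw [lnPlusFun_neg, lnMinusFun_neg, neg_sub]

theorem associatedWith_xNegSuccSgn_product :
    AssociatedWith
      (D.model (xNegSuccSgn 1) * D.model theta + D.model lnAbsSgn * D.model (pd delta))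
      (xPlusNegSucc 1 + (2 : ℂ) • delta) := by
  obtain ⟨l, C, hd⟩ := D.exists_isMollifier_net
  let R : Distr → moderate := fun u => ⟨D.rep u, D.isModerate_rep u⟩
  refine D.associatedWith_of_tendsto (R (xNegSuccSgn 1) * R theta + R lnAbsSgn * R (pd delta))
    (fun a x => conv (xNegSuccSgn 1) a x * conv theta a x
      + conv lnAbsSgn a x * conv (pd delta) a x) (fun _ => rfl) _ fun ψ => ?_
  simp only [integral_xNegSuccSgn_product]
  have hln := tendsto_integral_conv_mul_conv_theta hd locallyIntegrable_lnPlusFun_sub_lnMinusFun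
    (dTest (dTest ψ))
  simp only [sub_mul, lnPlusFun_mul_thetaFun, lnMinusFun_mul_thetaFun, sub_zero,
    ← lnAbsSgn_eq_ofFun] at hln
  have h := ((hln.neg.sub ((D.tendsto_integral_conv_lnAbsSgn_mul_net (dTest ψ)).const_mul 2)).sub
    (D.tendsto_integral_conv_theta_sq_net ψ)).add ((tendsto_integral_mollifier_sq hd ψ).const_mul 2)
  convert h using 2
  -- The ψ'(0) contained in x₊⁻² is supplied by the limit of the H² term.
  change xPlusNegSucc 1 ψ + 2 * ψ 0 = _
  rw [xPlusNegSucc_one_apply]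
  ring

theorem associatedWith_xPlusNegSucc_product :
    AssociatedWith
      (D.model (xPlusNegSucc 1) * D.model theta - D.model lnMinus * D.model (pd delta))
      (xPlusNegSucc 1 + delta) := by
  obtain ⟨l, C, hd⟩ := D.exists_isMollifier_net
  let R : Distr → moderate := fun u => ⟨D.rep u, D.isModerate_rep u⟩
  refine D.associatedWith_of_tendsto (R (xPlusNegSucc 1) * R theta - R lnMinus * R (pd delta))
    (fun a x => conv (xPlusNegSucc 1) a x * conv theta a x
      - conv lnMinus a x * conv (pd delta) a x) (fun _ => rfl) _ fun ψ => ?_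
  simp only [integral_xPlusNegSucc_product]
  have hln := tendsto_integral_conv_mul_conv_theta hd locallyIntegrable_lnPlusFun (dTest (dTest ψ))
  simp only [lnPlusFun_mul_thetaFun, ← show lnPlus = ofFun lnPlusFun from rfl]
    at hln
  have h := (((hln.neg.sub (D.tendsto_integral_conv_lnAbsSgn_mul_net (dTest ψ))).add
    (tendsto_integral_conv_log_dTest_mul_mollifier hd ψ)).sub
    ((D.tendsto_integral_conv_theta_sq_net ψ).const_mul (1 / 2))).add
    (tendsto_integral_mollifier_sq hd ψ)
  convert h using 2
  -- Here ψ'(0) arises as two halves, one from H² and one from the first moment of Λ'd.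
  change xPlusNegSucc 1 ψ + ψ 0 = _
  rw [xPlusNegSucc_one_apply]
  ring

end DeltaFamily

end Colombeau

end

theorem corollary1 (D : Colombeau.DeltaFamily) :
    Colombeau.AssociatedWith
      (D.model (Colombeau.xNegSuccSgn 1) * D.model Colombeau.theta +
        D.model Colombeau.lnAbsSgn * D.model (Colombeau.pd Colombeau.delta))
      (Colombeau.xPlusNegSucc 1 + (2 : ℂ) • Colombeau.delta) ∧
    Colombeau.AssociatedWith
      (D.model (Colombeau.xPlusNegSucc 1) * D.model Colombeau.theta -
        D.model Colombeau.lnMinus * D.model (Colombeau.pd Colombeau.delta))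
      (Colombeau.xPlusNegSucc 1 + Colombeau.delta) :=
  ⟨D.associatedWith_xNegSuccSgn_product, D.associatedWith_xPlusNegSucc_product⟩
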